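/- Let $\mathfrak g$ be a complex semisimple Lie algebra (finite-dimensional), $\mathfrak h\subset\mathfrak g$ a Cartan subalgebra, and fix a choice of simple roots. Let $D$ be a subset of the simple roots (a subdiagram of the Dynkin diagram), let $\mathfrak g_D\subseteq\mathfrak g$ be the subalgebra generated by the root spaces $\mathfrak g_{\pm\alpha}$, $\alpha\in D$, and let $\mathfrak l_D=\mathfrak g_D+\mathfrak h$ be the corresponding Levi subalgebra. Let $(\cdot,\cdot)$ be a non-degenerate, ad-invariant, symmetric bilinear form on $\mathfrak g$, and denote also by $(\cdot,\cdot)$ the form it induces on $\mathfrak h^*$. For each positive root $\alpha$ choose root vectors $e_\alpha\in\mathfrak g_\alpha$, $f_\alpha\in\mathfrak g_{-\alpha}$ with $[e_\alpha,f_\alpha]=h_\alpha$, the coroot of $\alpha$. Let $$r_{\mathfrak g}=\sum_{\alpha>0}\frac{(\alpha,\alpha)}2\,e_\alpha\wedge f_\alpha\in\textstyle\bigwedge^2\mathfrak g,\qquad r_D=\sum_{\alpha>0,\ \alpha\in R_D}\frac{(\alpha,\alpha)}2\,e_\alpha\wedge f_\alpha\in\textstyle\bigwedge^2\mathfrak g_D$$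 be the standard solutions of the modified classical Yang--Baxter equation for $\mathfrak g$ and $\mathfrak g_D$ corresponding to $(\cdot,\cdot)$ and to its restriction to $\mathfrak g_D$, where $R_D=\{\alpha : \mathfrak g_\alpha\subseteq\mathfrak g_D\}$ is the root system of $\mathfrak g_D$. Let $[\![\cdot,\cdot]\!]$ be the Schouten bracket on $\bigwedge\mathfrak g$, $$[\![X_1\wedge\cdots\wedge X_k,\,Y_1\wedge\cdots\wedge Y_l]\!]=\sum_{i,j}(-1)^{i+j}[X_i,Y_j]\wedge X_1\wedge\cdots\wedge\widehat{X_i}\wedge\cdots\wedge X_k\wedge Y_1\wedge\cdots\wedge\widehat{Y_j}\wedge\cdots\wedge Y_l,$$ and for a subalgebra $\mathfrak s\subseteq\mathfrak g$ let a superscript $\mathfrak s$ denote the invariants of $\mathfrak s$ for the adjoint action. Then $d=[\![r_{\mathfrak g}-r_D,\cdot]\!]$ maps $(\bigwedge^n\mathfrak g)^{\mathfrak l_D}$ to $(\bigwedge^{n+1}\mathfrak g)^{\mathfrak l_D}$ and $(\bigwedge^n\mathfrak g)^{\mathfrak g_D}$ to $(\bigwedge^{n+1}\mathfrak g)^{\mathfrak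 g_D}$ and squares to zero on both, $d$ vanishes on $(\bigwedge\mathfrak l_D)^{\mathfrak l_D}$, and the inclusions of cochain complexes $$\bigl((\textstyle\bigwedge\mathfrak l_D)^{\mathfrak l_D},0\bigr)\longrightarrow\bigl((\textstyle\bigwedge\mathfrak g)^{\mathfrak l_D},d\bigr)\longrightarrow\bigl((\textstyle\bigwedge\mathfrak g)^{\mathfrak g_D},d\bigr)$$ are quasi-isomorphisms. -/

import Mathlib

open CategoryTheory
open scoped BigOperators

noncomputable section

namespace RelTwist

universe u

/-! ### Contractions, derivations and the Schouten bracket on the exterior algebra -/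

section Exterior

variable {𝔤 : Type u} [LieRing 𝔤] [LieAlgebra ℂ 𝔤]

/-- Contraction of an element of the exterior algebra by a linear form `v`, that is
`X₁ ∧ ⋯ ∧ Xₖ ↦ ∑ i, (-1)^(i-1) v(Xᵢ) X₁ ∧ ⋯ ∧ X̂ᵢ ∧ ⋯ ∧ Xₖ`; see `contr_ιMulti`. -/
def contr (v : Module.Dual ℂ 𝔤) : ExteriorAlgebra ℂ 𝔤 →ₗ[ℂ] ExteriorAlgebra ℂ 𝔤 :=
  CliffordAlgebra.contractLeft (Q := (0 : QuadraticForm ℂ 𝔤)) v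

lemma contr_algebraMap (v : Module.Dual ℂ 𝔤) (c : ℂ) :
    contr v (algebraMap ℂ (ExteriorAlgebra ℂ 𝔤) c) = 0 :=
  CliffordAlgebra.contractLeft_algebraMap _ _ _

lemma contr_one (v : Module.Dual ℂ 𝔤) : contr v (1 : ExteriorAlgebra ℂ 𝔤) = 0 :=
  CliffordAlgebra.contractLeft_one _ _

lemma contr_ι_mul (v : Module.Dual ℂ 𝔤) (x : 𝔤) (ω : ExteriorAlgebra ℂ 𝔤) :
    contr v (ExteriorAlgebra.ι ℂ x * ω) = v x • ω - ExteriorAlgebra.ι ℂ x * contr v ω :=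
  CliffordAlgebra.contractLeft_ι_mul _ _ _

lemma contr_ιMulti (v : Module.Dual ℂ 𝔤) (k : ℕ) (X : Fin (k + 1) → 𝔤) :
    contr v (ExteriorAlgebra.ιMulti ℂ (k + 1) X) =
      ∑ i : Fin (k + 1), ((-1 : ℂ) ^ (i : ℕ) * v (X i)) •
        ExteriorAlgebra.ιMulti ℂ k (fun m => X (i.succAbove m)) := by
  induction k with
  | zero => simpa [contr_one] using contr_ι_mul v (X 0) 1
  | succ k ih =>
    rw [ExteriorAlgebra.ιMulti_succ_apply, contr_ι_mul, ih, sub_eq_add_neg, Finset.mul_sum,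
      ← Finset.sum_neg_distrib, Fin.sum_univ_succ (n := k + 1)]
    refine congrArg₂ (· + ·) ?_ (Finset.sum_congr rfl fun i _ => ?_)
    · simp [Matrix.vecTail, Function.comp_def]
    · rw [ExteriorAlgebra.ιMulti_succ_apply (v := fun m => X (i.succ.succAbove m))]
      simp [Matrix.vecTail, Function.comp_def, pow_succ]

variable [FiniteDimensional ℂ 𝔤]

/-- The derivation `T^∧` of the exterior algebra which extends `T ∈ End 𝔤`, that is
`X₁ ∧ ⋯ ∧ Xₖ ↦ ∑ i, X₁ ∧ ⋯ ∧ T Xᵢ ∧ ⋯ ∧ Xₖ`. It is written through a basis of `𝔤` and the dual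
basis; `derivExt_one`, `derivExt_ι` and `derivExt_mul` characterise it. -/
def derivExt (T : 𝔤 →ₗ[ℂ] 𝔤) : ExteriorAlgebra ℂ 𝔤 →ₗ[ℂ] ExteriorAlgebra ℂ 𝔤 :=
  ∑ a, LinearMap.mulLeft ℂ (ExteriorAlgebra.ι ℂ (T (Module.finBasis ℂ 𝔤 a))) ∘ₗ
    contr ((Module.finBasis ℂ 𝔤).coord a)

lemma derivExt_apply (T : 𝔤 →ₗ[ℂ] 𝔤) (ω : ExteriorAlgebra ℂ 𝔤) :
    derivExt T ω = ∑ a, ExteriorAlgebra.ι ℂ (T (Module.finBasis ℂ 𝔤 a)) *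
      contr ((Module.finBasis ℂ 𝔤).coord a) ω := by
  simp [derivExt]

lemma derivExt_algebraMap (T : 𝔤 →ₗ[ℂ] 𝔤) (c : ℂ) :
    derivExt T (algebraMap ℂ (ExteriorAlgebra ℂ 𝔤) c) = 0 := by
  simp [derivExt_apply, contr_algebraMap]

lemma derivExt_one (T : 𝔤 →ₗ[ℂ] 𝔤) : derivExt T 1 = 0 := by
  simp [derivExt_apply, contr_one]

lemma sum_coord_smul_ι (T : 𝔤 →ₗ[ℂ] 𝔤) (x : 𝔤) :
    ∑ a, (Module.finBasis ℂ 𝔤).coord a x •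
      ExteriorAlgebra.ι ℂ (T (Module.finBasis ℂ 𝔤 a)) = ExteriorAlgebra.ι ℂ (T x) := by
  have h := congrArg (fun y => ExteriorAlgebra.ι ℂ (T y)) ((Module.finBasis ℂ 𝔤).sum_repr x)
  simp only [map_sum, map_smul] at h
  simpa only [Module.Basis.coord_apply] using h

lemma derivExt_ι_mul (T : 𝔤 →ₗ[ℂ] 𝔤) (x : 𝔤) (ω : ExteriorAlgebra ℂ 𝔤) :
    derivExt T (ExteriorAlgebra.ι ℂ x * ω) =
      ExteriorAlgebra.ι ℂ (T x) * ω + ExteriorAlgebra.ι ℂ x * derivExt T ω := by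
  have key : ∀ y : 𝔤, ExteriorAlgebra.ι ℂ y * ExteriorAlgebra.ι ℂ x =
      -(ExteriorAlgebra.ι ℂ x * ExteriorAlgebra.ι ℂ y) := fun y =>
    eq_neg_of_add_eq_zero_left (ExteriorAlgebra.ι_add_mul_swap y x)
  rw [derivExt_apply, derivExt_apply, Finset.mul_sum, ← sum_coord_smul_ι T x, Finset.sum_mul,
    ← Finset.sum_add_distrib]
  refine Finset.sum_congr rfl fun a _ => ?_
  rw [contr_ι_mul, mul_sub, ← mul_assoc, key, mul_smul_comm, smul_mul_assoc, neg_mul, mul_assoc,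
    sub_neg_eq_add]

lemma derivExt_ι (T : 𝔤 →ₗ[ℂ] 𝔤) (x : 𝔤) :
    derivExt T (ExteriorAlgebra.ι ℂ x) = ExteriorAlgebra.ι ℂ (T x) := by
  simpa [derivExt_one] using derivExt_ι_mul T x 1

lemma derivExt_mul (T : 𝔤 →ₗ[ℂ] 𝔤) (ω η : ExteriorAlgebra ℂ 𝔤) :
    derivExt T (ω * η) = derivExt T ω * η + ω * derivExt T η := by
  induction ω using ExteriorAlgebra.induction generalizing η with
  | algebraMap c => simp [derivExt_algebraMap, ← Algebra.smul_def]
  | ι x => rw [derivExt_ι_mul, derivExt_ι]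
  | mul a b ha hb => rw [mul_assoc, ha, hb, ha, mul_add, add_mul]; simp only [mul_assoc, add_assoc]
  | add a b ha hb => simp only [add_mul, map_add, ha, hb]; abel

/-- The Schouten bracket `⟦·,·⟧` on the exterior algebra of a finite-dimensional Lie algebra,
`⟦X₁ ∧ ⋯ ∧ Xₖ, Y₁ ∧ ⋯ ∧ Yₗ⟧ =
  ∑ i j, (-1)^(i+j) [Xᵢ, Yⱼ] ∧ X₁ ∧ ⋯ ∧ X̂ᵢ ∧ ⋯ ∧ Xₖ ∧ Y₁ ∧ ⋯ ∧ Ŷⱼ ∧ ⋯ ∧ Yₗ`.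
It is written through a basis of `𝔤` and the dual basis; `schouten_ιMulti`,
`schouten_algebraMap_left` and `schouten_algebraMap_right` give its values on decomposable
elements. -/
def schouten : ExteriorAlgebra ℂ 𝔤 →ₗ[ℂ] ExteriorAlgebra ℂ 𝔤 →ₗ[ℂ] ExteriorAlgebra ℂ 𝔤 :=
  ∑ a, ∑ b,
    (LinearMap.mul ℂ (ExteriorAlgebra ℂ 𝔤)).compl₁₂
      (LinearMap.mulLeft ℂ
          (ExteriorAlgebra.ι ℂ ⁅Module.finBasis ℂ 𝔤 a, Module.finBasis ℂ 𝔤 b⁆) ∘ₗ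
        contr ((Module.finBasis ℂ 𝔤).coord a))
      (contr ((Module.finBasis ℂ 𝔤).coord b))

lemma schouten_apply (ω η : ExteriorAlgebra ℂ 𝔤) :
    schouten ω η = ∑ a, ∑ b,
      ExteriorAlgebra.ι ℂ ⁅Module.finBasis ℂ 𝔤 a, Module.finBasis ℂ 𝔤 b⁆ *
        contr ((Module.finBasis ℂ 𝔤).coord a) ω * contr ((Module.finBasis ℂ 𝔤).coord b) η := by
  simp [schouten, LinearMap.sum_apply]

lemma schouten_algebraMap_left (c : ℂ) (η : ExteriorAlgebra ℂ 𝔤) :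
    schouten (algebraMap ℂ _ c) η = 0 := by
  simp [schouten_apply, contr_algebraMap]

lemma schouten_algebraMap_right (c : ℂ) (ω : ExteriorAlgebra ℂ 𝔤) :
    schouten ω (algebraMap ℂ _ c) = 0 := by
  simp [schouten_apply, contr_algebraMap]

lemma sum_sum_coord_smul_ι (x y : 𝔤) :
    ∑ a, ∑ b, ((Module.finBasis ℂ 𝔤).coord a x * (Module.finBasis ℂ 𝔤).coord b y) •
      ExteriorAlgebra.ι ℂ ⁅Module.finBasis ℂ 𝔤 a, Module.finBasis ℂ 𝔤 b⁆ =
        ExteriorAlgebra.ι ℂ ⁅x, y⁆ := by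
  have h1 : ∀ z : 𝔤, ∑ b, (Module.finBasis ℂ 𝔤).coord b y •
      ExteriorAlgebra.ι ℂ ⁅z, Module.finBasis ℂ 𝔤 b⁆ = ExteriorAlgebra.ι ℂ ⁅z, y⁆ := fun z =>
    sum_coord_smul_ι (LieAlgebra.ad ℂ 𝔤 z) y
  have h2 := sum_coord_smul_ι (-LieAlgebra.ad ℂ 𝔤 y) x
  simp only [LinearMap.neg_apply, LieAlgebra.ad_apply, lie_skew] at h2
  simp_rw [mul_smul, ← Finset.smul_sum, h1, h2]

/-- With indices starting from `0`, the sign `(-1)^(i+j)` is the same as with indices starting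
from `1`. -/
lemma schouten_ιMulti (k l : ℕ) (X : Fin (k + 1) → 𝔤) (Y : Fin (l + 1) → 𝔤) :
    schouten (ExteriorAlgebra.ιMulti ℂ (k + 1) X) (ExteriorAlgebra.ιMulti ℂ (l + 1) Y) =
      ∑ i : Fin (k + 1), ∑ j : Fin (l + 1), ((-1 : ℂ) ^ ((i : ℕ) + (j : ℕ))) •
        (ExteriorAlgebra.ι ℂ ⁅X i, Y j⁆ *
          ExteriorAlgebra.ιMulti ℂ k (fun m => X (i.succAbove m)) *
          ExteriorAlgebra.ιMulti ℂ l (fun m => Y (j.succAbove m))) := by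
  have swap : ∀ F : Fin (Module.finrank ℂ 𝔤) → Fin (Module.finrank ℂ 𝔤) → Fin (k + 1) →
      Fin (l + 1) → ExteriorAlgebra ℂ 𝔤,
      ∑ a, ∑ b, ∑ i, ∑ j, F a b i j = ∑ i, ∑ j, ∑ a, ∑ b, F a b i j := by
    intro F
    rw [Finset.sum_congr rfl (fun a _ => Finset.sum_comm), Finset.sum_comm]
    refine Finset.sum_congr rfl fun i _ => ?_
    rw [Finset.sum_congr rfl (fun a _ => Finset.sum_comm), Finset.sum_comm]
  rw [schouten_apply]
  simp only [contr_ιMulti, Finset.mul_sum, Finset.sum_mul]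
  have swap2 : ∀ G : Fin (l + 1) → Fin (k + 1) → ExteriorAlgebra ℂ 𝔤,
      ∑ j, ∑ i, G j i = ∑ i, ∑ j, G j i := fun G => Finset.sum_comm
  simp only [swap2]
  rw [swap]
  refine Finset.sum_congr rfl fun i _ => Finset.sum_congr rfl fun j _ => ?_
  rw [← sum_sum_coord_smul_ι (X i) (Y j)]
  simp only [Finset.sum_mul, Finset.smul_sum]
  refine Finset.sum_congr rfl fun a _ => Finset.sum_congr rfl fun b _ => ?_
  simp only [mul_smul_comm, smul_mul_assoc, smul_smul]
  congr 1
  ring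

/-- The subspace `(⋀ 𝔤)^𝔰` of invariants of a Lie subalgebra `𝔰` of `𝔤` for the adjoint action on
the exterior algebra. -/
def invariants (𝔰 : LieSubalgebra ℂ 𝔤) : Submodule ℂ (ExteriorAlgebra ℂ 𝔤) :=
  ⨅ x : 𝔰, LinearMap.ker (derivExt (LieAlgebra.ad ℂ 𝔤 (x : 𝔤)))

lemma mem_invariants {𝔰 : LieSubalgebra ℂ 𝔤} {ω : ExteriorAlgebra ℂ 𝔤} :
    ω ∈ invariants 𝔰 ↔ ∀ x ∈ 𝔰, derivExt (LieAlgebra.ad ℂ 𝔤 x) ω = 0 := by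
  simp [invariants, Submodule.mem_iInf]

/-- The degree `n` part `(⋀ⁿ 𝔤)^𝔰` of `(⋀ 𝔤)^𝔰`. -/
def invPart (𝔰 : LieSubalgebra ℂ 𝔤) (n : ℕ) : Submodule ℂ (ExteriorAlgebra ℂ 𝔤) :=
  ⋀[ℂ]^n 𝔤 ⊓ invariants 𝔰

/-- The degree `n` part `(⋀ⁿ 𝔰)^𝔰` of `(⋀ 𝔰)^𝔰`, as a subspace of `⋀ 𝔤`. -/
def selfInvPart (𝔰 : LieSubalgebra ℂ 𝔤) (n : ℕ) : Submodule ℂ (ExteriorAlgebra ℂ 𝔤) :=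
  (⋀[ℂ]^n 𝔰).map (ExteriorAlgebra.map (𝔰.toSubmodule.subtype)).toLinearMap ⊓ invariants 𝔰

end Exterior

/-! ### Cochain complexes of subspaces of a vector space -/

section Complexes

variable {E : Type u} [AddCommGroup E] [Module ℂ E]

/-- `d` makes the family of subspaces `V 0, V 1, …` into a cochain complex. -/
structure IsCochainDatum (V : ℕ → Submodule ℂ E) (d : E →ₗ[ℂ] E) : Prop where
  map_mem : ∀ n, ∀ x ∈ V n, d x ∈ V (n + 1)
  sq_zero : ∀ n, ∀ x ∈ V n, d (d x) = 0

/-- The cochain complex `V 0 → V 1 → ⋯` with differential the restriction of `d`. -/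
def subComplex (V : ℕ → Submodule ℂ E) (d : E →ₗ[ℂ] E) (h : IsCochainDatum V d) :
    CochainComplex (ModuleCat.{u} ℂ) ℕ :=
  CochainComplex.of (fun n => ModuleCat.of ℂ (V n))
    (fun n => ModuleCat.ofHom (d.restrict (h.map_mem n)))
    (fun n => by
      ext x
      exact h.sq_zero n x x.2)

/-- The inclusion of the complex `(V, d)` into the complex `(W, d')`, where `V n ⊆ W n` and `d'`
agrees with `d` on `V n`. -/
def subComplexIncl {V W : ℕ → Submodule ℂ E} {d d' : E →ₗ[ℂ] E} (hV : IsCochainDatum V d)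
    (hW : IsCochainDatum W d') (hle : ∀ n, V n ≤ W n) (hd : ∀ n, ∀ x ∈ V n, d x = d' x) :
    subComplex V d hV ⟶ subComplex W d' hW :=
  CochainComplex.ofHom
    (fun n => ModuleCat.ofHom (Submodule.inclusion (hle n)))
    (fun n => by
      simp only [subComplex, CochainComplex.of_d]
      ext x
      exact (hd n x x.2).symm)

end Complexes

/-! ### Diagrammatic subalgebras -/

section Diagram

variable {𝔤 : Type u} [LieRing 𝔤] [LieAlgebra ℂ 𝔤] [FiniteDimensional ℂ 𝔤]
  {H : LieSubalgebra ℂ 𝔤} [H.IsCartanSubalgebra]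

/-- The subalgebra `𝔤_D` generated by the root vectors `e_α, f_α`, `α ∈ D`, for a set `D` of simple
roots. -/
def diagSubalgebra (D : Set H.root) : LieSubalgebra ℂ 𝔤 :=
  LieSubalgebra.lieSpan ℂ 𝔤
    {x | ∃ α ∈ D, x ∈ LieAlgebra.rootSpace H α.1 ∨ x ∈ LieAlgebra.rootSpace H (-α.1 : H → ℂ)}

/-- The Levi subalgebra `𝔩_D = 𝔤_D + H`; the sum of subspaces is a subalgebra, see
`toSubmodule_levi`. -/
def levi (D : Set H.root) : LieSubalgebra ℂ 𝔤 := diagSubalgebra D ⊔ H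

lemma toSubmodule_levi (D : Set H.root) :
    (levi D).toSubmodule = (diagSubalgebra D).toSubmodule ⊔ H.toSubmodule := by
  have stable : ∀ h ∈ H, ∀ x ∈ diagSubalgebra D, ⁅h, x⁆ ∈ diagSubalgebra D := by
    intro h hh x hx
    induction hx using LieSubalgebra.lieSpan_induction with
    | mem x hx =>
      refine LieSubalgebra.subset_lieSpan ?_
      obtain ⟨α, hα, hx | hx⟩ := hx
      · exact ⟨α, hα, Or.inl (LieSubmodule.lie_mem _ (x := (⟨h, hh⟩ : H)) hx)⟩
      · exact ⟨α, hα, Or.inr (LieSubmodule.lie_mem _ (x := (⟨h, hh⟩ : H)) hx)⟩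
    | zero => simp
    | add x y _ _ h1 h2 => rw [lie_add]; exact add_mem h1 h2
    | smul c x _ h1 => rw [lie_smul]; exact (diagSubalgebra D).smul_mem c h1
    | lie x y hx hy h1 h2 =>
      rw [leibniz_lie]
      exact add_mem ((diagSubalgebra D).lie_mem h1 hy) ((diagSubalgebra D).lie_mem hx h2)
  let K : LieSubalgebra ℂ 𝔤 :=
    { (diagSubalgebra D).toSubmodule ⊔ H.toSubmodule with
      lie_mem' := by
        intro x y hx hy
        obtain ⟨x₁, hx₁, x₂, hx₂, rfl⟩ := Submodule.mem_sup.1 hx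
        obtain ⟨y₁, hy₁, y₂, hy₂, rfl⟩ := Submodule.mem_sup.1 hy
        refine Submodule.mem_sup.2 ⟨⁅x₁, y₁⁆ + ⁅x₂, y₁⁆ + ⁅x₁, y₂⁆, ?_, ⁅x₂, y₂⁆,
          H.lie_mem hx₂ hy₂, ?_⟩
        · refine add_mem (add_mem ((diagSubalgebra D).lie_mem hx₁ hy₁) (stable _ hx₂ _ hy₁)) ?_
          rw [← lie_skew]
          exact neg_mem (stable _ hy₂ _ hx₁)
        · simp only [lie_add, add_lie]
          abel }
  apply le_antisymm
  · have : levi D ≤ K := sup_le (fun x hx => Submodule.mem_sup_left hx)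
      (fun x hx => Submodule.mem_sup_right hx)
    exact this
  · exact sup_le (fun x hx => (le_sup_left : diagSubalgebra D ≤ levi D) hx)
      (fun x hx => (le_sup_right : H ≤ levi D) hx)

/-- The root system `R_D` of `𝔤_D`, as a set of roots of `𝔤`. -/
def diagRoots (D : Set H.root) : Set H.root :=
  {α | ∀ x ∈ LieAlgebra.rootSpace H α.1, x ∈ diagSubalgebra D}

end Diagram

/-! ### Standard solutions of the modified classical Yang–Baxter equation -/

section Semisimple

variable {𝔤 : Type u} [LieRing 𝔤] [LieAlgebra ℂ 𝔤] [FiniteDimensional ℂ 𝔤]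
  [LieAlgebra.IsSemisimple ℂ 𝔤]

variable (𝔤) in
/-- A non-degenerate, ad-invariant, symmetric bilinear form on `𝔤`. -/
structure InvForm where
  form : LinearMap.BilinForm ℂ 𝔤
  nondegenerate : form.Nondegenerate
  symm : form.IsSymm
  invariant : form.lieInvariant 𝔤

variable {H : LieSubalgebra ℂ 𝔤} [H.IsCartanSubalgebra]

/-- A non-degenerate invariant form is non-degenerate on a Cartan subalgebra. -/
lemma InvForm.restrict_nondegenerate (B : InvForm 𝔤) (H : LieSubalgebra ℂ 𝔤)
    [H.IsCartanSubalgebra] : (B.form.restrict H.toSubmodule).Nondegenerate := by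
  have left : (B.form.restrict H.toSubmodule).SeparatingLeft := by
    intro x hx
    have hx' : ∀ y ∈ H, B.form x y = 0 := fun y hy => hx ⟨y, hy⟩
    have key : (⊤ : Submodule ℂ 𝔤) ≤ LinearMap.ker (B.form x) := by
      rw [← LieSubmodule.top_toSubmodule (R := ℂ) (L := H),
        ← LieModule.iSup_genWeightSpace_eq_top' ℂ H 𝔤, LieSubmodule.iSup_toSubmodule]
      refine iSup_le fun χ y hy => ?_
      rw [LinearMap.mem_ker]
      by_cases hχ : χ.IsZero
      · have h0 : y ∈ LieAlgebra.rootSpace H (0 : H → ℂ) := by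
          have := (LieSubmodule.mem_toSubmodule _).1 hy
          rwa [show (χ : H → ℂ) = 0 from hχ] at this
        rw [LieAlgebra.rootSpace_zero_eq] at h0
        exact hx' y h0
      · obtain ⟨h, hh⟩ : ∃ h : H, χ h ≠ 0 := by
          by_contra hcon
          push Not at hcon
          exact hχ (funext hcon)
        have h1 : ⁅h, y⁆ = χ h • y :=
          LieAlgebra.IsKilling.lie_eq_smul_of_mem_rootSpace hy h
        have h2 : ⁅(h : 𝔤), (x : 𝔤)⁆ = 0 := by
          have : ⁅h, x⁆ = 0 := trivial_lie_zero H H h x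
          exact congrArg Subtype.val this
        have h3 := B.invariant (h : 𝔤) (x : 𝔤) y
        rw [h2, map_zero, LinearMap.zero_apply] at h3
        have h4 : ⁅(h : 𝔤), y⁆ = χ h • y := h1
        rw [h4, map_smul, smul_eq_mul] at h3
        have h5 : χ h * B.form x y = 0 := by linear_combination h3
        exact (mul_eq_zero.1 h5).resolve_left hh
    have hz : (x : 𝔤) = 0 :=
      B.nondegenerate.1 x fun y => LinearMap.mem_ker.1 (key Submodule.mem_top)
    exact Subtype.ext hz
  refine ⟨left, fun y hy => left y fun x => ?_⟩
  have := hy x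
  exact (B.symm.eq y x).symm ▸ this

/-- The symmetric bilinear form `(·,·)` on `H*` induced by the form on `H`. -/
def InvForm.dualForm (B : InvForm 𝔤) (H : LieSubalgebra ℂ 𝔤) [H.IsCartanSubalgebra]
    (φ ψ : Module.Dual ℂ H) : ℂ :=
  B.form.restrict H.toSubmodule
    (((B.form.restrict H.toSubmodule).toDual (B.restrict_nondegenerate H)).symm φ)
    (((B.form.restrict H.toSubmodule).toDual (B.restrict_nondegenerate H)).symm ψ)

/-- `e` and `f` choose root vectors `e_α ∈ 𝔤_α`, `f_α ∈ 𝔤_{-α}` with `[e_α, f_α] = h_α` for every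
positive root `α`. -/
def IsRootVectors (b : (LieAlgebra.IsKilling.rootSystem H).Base) (e f : H.root → 𝔤) : Prop :=
  ∀ α : H.root, b.IsPos α →
    e α ∈ LieAlgebra.rootSpace H α.1 ∧ f α ∈ LieAlgebra.rootSpace H (-α.1 : H → ℂ) ∧
      ⁅e α, f α⁆ = (LieAlgebra.IsKilling.coroot α.1 : H)

open scoped Classical in
/-- The element `∑ (α,α)/2 e_α ∧ f_α` of `⋀² 𝔤`, the sum being over the positive roots in `R`. -/
def standardR (B : InvForm 𝔤) (b : (LieAlgebra.IsKilling.rootSystem H).Base) (e f : H.root → 𝔤)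
    (R : Set H.root) : ExteriorAlgebra ℂ 𝔤 :=
  ∑ α : H.root with b.IsPos α ∧ α ∈ R,
    (B.dualForm H (LieAlgebra.IsKilling.rootSystem H |>.root α)
      (LieAlgebra.IsKilling.rootSystem H |>.root α) / 2) •
      (ExteriorAlgebra.ι ℂ (e α) * ExteriorAlgebra.ι ℂ (f α))

/-- The standard solution `r_𝔤` of the modified classical Yang–Baxter equation for `𝔤`. -/
def rG (B : InvForm 𝔤) (b : (LieAlgebra.IsKilling.rootSystem H).Base) (e f : H.root → 𝔤) :
    ExteriorAlgebra ℂ 𝔤 :=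
  standardR B b e f Set.univ

/-- The standard solution `r_D` of the modified classical Yang–Baxter equation for `𝔤_D`, relative
to the restriction of the form to `𝔤_D`; for `α ∈ R_D` the number `(α,α)` is the same for the form
on `𝔤` and for its restriction to `𝔤_D`. -/
def rD (B : InvForm 𝔤) (b : (LieAlgebra.IsKilling.rootSystem H).Base) (e f : H.root → 𝔤)
    (D : Set H.root) : ExteriorAlgebra ℂ 𝔤 :=
  standardR B b e f (diagRoots D)

end Semisimple

end RelTwist

end

open RelTwist

/-! Let z ∈ H be the element on which the simple roots in D vanish and the other simple roots take
the value 1. Then 𝔩_D is the centraliser of z. Through the invariant form the bivector r_𝔤 - r_D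
becomes the operator S = -sign(ad z), and the differential becomes d = ∑ E_a ∧ ad(S E^a) for dual
bases (E_a), (E^a); see `schouten_standardR` and `isSignOperator_standardOperator`.

Contraction ι_z by the linear form (z, ·) is a homotopy: ι_z d + d ι_z = N, where N is the
derivation of ⋀𝔤 extending |ad z| (`contr_twistD`). N is diagonalisable with natural eigenvalues and
its kernel is ⋀𝔩_D. So an invariant cocycle in a nonzero eigenspace of N is a coboundary, and only
⋀𝔩_D remains (`exists_add_twistD_contr_eq`). On ⋀𝔩_D the differential vanishes, and the projection
⋀𝔤 → ⋀𝔩_D kills all coboundaries, so distinct invariants there have distinct classes.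

The square of d vanishes only on invariants. With π = 1 - S², the projection to 𝔩_D, the Yang–Baxter
expression of S is -[x, y] + [πx, πy] (`yangBaxter`). The first term contributes nothing, by the
Jacobi identity and invariance of the form; the second acts through [𝔩_D, 𝔩_D] ⊆ 𝔤_D, hence by zero
on invariants (`twistD_twistD`).

Finally 𝔩_D is 𝔤_D plus its own centre, and this centre acts trivially on ⋀𝔩_D. Hence (⋀𝔩_D)^𝔩_D is
the part fixed by the projection in the invariants of 𝔤_D as well as in those of 𝔩_D. Its inclusion
into either complex is a quasi-isomorphism, and two-out-of-three gives the inclusion between them.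
-/

noncomputable section

namespace RelTwist

universe u

/-! ### Quasi-isomorphisms out of complexes with zero differential -/

section QuasiIsomorphisms

/-- A morphism of short complexes of modules whose source has zero second map is a quasi-isomorphism as
soon as it identifies the middle term of the source with a complement of the boundaries in the
cycles. -/
lemma shortComplex_quasiIso_of_zero {S₁ S₂ : ShortComplex (ModuleCat.{u} ℂ)} (φ : S₁ ⟶ S₂)
    (hg : S₁.g = 0)
    (hinj : ∀ x : S₁.X₂, (∃ y : S₂.X₁, S₂.f y = φ.τ₂ x) → x = 0)
    (hsurj : ∀ y : S₂.X₂, S₂.g y = 0 → ∃ (x : S₁.X₂) (w : S₂.X₁), φ.τ₂ x + S₂.f w = y) :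
    ShortComplex.QuasiIso φ := by
  let h₁ := S₁.moduleCatLeftHomologyData
  let h₂ := S₂.moduleCatLeftHomologyData
  let γ : ShortComplex.LeftHomologyMapData φ h₁ h₂ := default
  have hi : ∀ k : h₁.K, h₂.i (γ.φK k) = φ.τ₂ (h₁.i k) := fun k =>
    congrArg (fun m => m.hom k) γ.commi
  have hπ : ∀ k : h₁.K, γ.φH (h₁.π k) = h₂.π (γ.φK k) := fun k =>
    congrArg (fun m => m.hom k) γ.commπ
  rw [γ.quasiIso_iff, ConcreteCategory.isIso_iff_bijective]
  constructor
  · refine (injective_iff_map_eq_zero (γ.φH.hom)).2 fun a ha => ?_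
    obtain ⟨k, rfl⟩ := Submodule.mkQ_surjective _ a
    have h0 : h₂.π (γ.φK k) = 0 := (hπ k).symm.trans ha
    obtain ⟨w, hw⟩ := (Submodule.Quotient.mk_eq_zero _).1 h0
    have hk : h₁.i k = 0 :=
      hinj _ ⟨w, (congrArg (fun m : LinearMap.ker S₂.g.hom => (m : S₂.X₂)) hw).trans (hi k)⟩
    have hk0 : k = 0 := Subtype.ext hk
    rw [hk0, map_zero]
    rfl
  · intro a
    obtain ⟨k, rfl⟩ := Submodule.mkQ_surjective _ a
    obtain ⟨x, w, hxw⟩ := hsurj (h₂.i k) k.2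
    let kx : LinearMap.ker S₁.g.hom := ⟨x, by rw [hg]; rfl⟩
    refine ⟨h₁.π kx, (hπ kx).trans ?_⟩
    refine (Submodule.Quotient.eq _).2 ⟨-w, Subtype.ext ?_⟩
    change S₂.f (-w) = h₂.i (γ.φK kx) - h₂.i k
    rw [hi kx, ← hxw, map_neg]
    change -(S₂.f w) = φ.τ₂ x - _
    abel

variable {E : Type u} [AddCommGroup E] [Module ℂ E]

lemma subComplex_d (V : ℕ → Submodule ℂ E) (d : E →ₗ[ℂ] E) (h : IsCochainDatum V d) (n : ℕ) :
    (subComplex V d h).d n (n + 1) = ModuleCat.ofHom (d.restrict (h.map_mem n)) :=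
  (CochainComplex.of_d (fun n => ModuleCat.of ℂ (V n))
    (fun n => ModuleCat.ofHom (d.restrict (h.map_mem n))) n :)

/-- The inclusion of a family of subspaces with zero differential is a quasi-isomorphism as soon as
these subspaces represent each cohomology class of the target exactly once. -/
lemma quasiIso_subComplexIncl_of_zero {V W : ℕ → Submodule ℂ E} {d : E →ₗ[ℂ] E}
    (hV : IsCochainDatum V 0) (hW : IsCochainDatum W d) (hle : ∀ n, V n ≤ W n)
    (hd : ∀ n, ∀ x ∈ V n, (0 : E →ₗ[ℂ] E) x = d x)
    (hinj : ∀ n, ∀ y ∈ W n, d y ∈ V (n + 1) → d y = 0)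
    (hsurj₀ : ∀ x ∈ W 0, d x = 0 → x ∈ V 0)
    (hsurj : ∀ n, ∀ x ∈ W (n + 1), d x = 0 → ∃ v ∈ V (n + 1), ∃ y ∈ W n, v + d y = x) :
    QuasiIso (subComplexIncl hV hW hle hd) := by
  have hz : ∀ n, (subComplex V 0 hV).d n (n + 1) = 0 := fun n => by
    rw [subComplex_d]
    ext x
    rfl
  refine ⟨fun n => ?_⟩
  rcases n with _ | n
  -- The predecessor of degree 0 is 0 itself, by convention; the differential from 0 to 0 is zero,
  -- so there are no coboundaries in this degree.
  · rw [quasiIsoAt_iff' _ 0 0 1 (by simp) (by simp)]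
    refine shortComplex_quasiIso_of_zero _ (hz 0) ?_ ?_
    · rintro x ⟨y, hy⟩
      have h0 : (subComplex W d hW).d 0 0 = 0 := (subComplex W d hW).shape 0 0 (by simp)
      have h1 : ((subComplex W d hW).d 0 0) y = (subComplexIncl hV hW hle hd).f 0 x := hy
      rw [h0] at h1
      exact Subtype.ext (congrArg Subtype.val h1).symm
    · intro y hy
      have h1 : ((subComplex W d hW).d 0 1) y = 0 := hy
      rw [subComplex_d] at h1
      refine ⟨⟨y.1, hsurj₀ _ y.2 (congrArg Subtype.val h1)⟩, 0, ?_⟩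
      rw [map_zero, add_zero]
      rfl
  · rw [quasiIsoAt_iff' _ n (n + 1) (n + 2) (by simp) (by simp)]
    refine shortComplex_quasiIso_of_zero _ (hz (n + 1)) ?_ ?_
    · rintro x ⟨y, hy⟩
      have h1 : ((subComplex W d hW).d n (n + 1)) y =
        (subComplexIncl hV hW hle hd).f (n + 1) x := hy
      rw [subComplex_d] at h1
      have h2 : d y.1 = x.1 := congrArg Subtype.val h1
      refine Subtype.ext (h2.symm.trans (hinj n y.1 y.2 ?_))
      rw [h2]
      exact x.2
    · intro y hy
      have h1 : ((subComplex W d hW).d (n + 1) (n + 2)) y = 0 := hy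
      rw [subComplex_d] at h1
      obtain ⟨v, hv, w, hw, hvw⟩ := hsurj n y.1 y.2 (congrArg Subtype.val h1)
      refine ⟨⟨v, hv⟩, ⟨w, hw⟩, ?_⟩
      change (subComplexIncl hV hW hle hd).f (n + 1) ⟨v, hv⟩ +
        ((subComplex W d hW).d n (n + 1)) ⟨w, hw⟩ = y
      rw [subComplex_d]
      exact Subtype.ext hvw

end QuasiIsomorphisms

/-- If a spanning set of eigenvectors of `A` consists of eigenvectors of `B`, the eigenvalue of `B`
being a function of that of `A`, then the same holds for all eigenvectors of `A`. -/
lemma apply_eq_smul_of_span_eigenvectors {V : Type*} [AddCommGroup V] [Module ℂ V]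
    {A B : Module.End ℂ V} {s : ℂ → ℂ}
    (hspan : Submodule.span ℂ {x | ∃ μ : ℂ, A x = μ • x ∧ B x = s μ • x} = ⊤)
    {x : V} {μ : ℂ} (hx : A x = μ • x) : B x = s μ • x := by
  let E : ℂ → Submodule ℂ V := fun μ => A.eigenspace μ ⊓ B.eigenspace (s μ)
  have htop : ⨆ μ, E μ = ⊤ := by
    rw [eq_top_iff, ← hspan, Submodule.span_le]
    rintro y ⟨ν, h1, h2⟩
    exact Submodule.mem_iSup_of_mem ν
      ⟨Module.End.mem_eigenspace_iff.2 h1, Module.End.mem_eigenspace_iff.2 h2⟩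
  -- The joint eigenspaces already span and lie in the independent eigenspaces of `A`, so they must
  -- fill them.
  have hE := (A.eigenspaces_iSupIndep.le_iff_eq_of_iSup_eq_top htop).1 (fun μ => inf_le_left)
  have h3 : x ∈ E μ := by
    rw [congrFun hE μ]
    exact Module.End.mem_eigenspace_iff.2 hx
  exact Module.End.mem_eigenspace_iff.1 h3.2

/-! ### Contractions and derivations of the exterior algebra -/

section ExteriorAlgebraLemmas

variable {𝔤 : Type u} [LieRing 𝔤] [LieAlgebra ℂ 𝔤]

lemma exteriorAlgebra_left_induction {P : ExteriorAlgebra ℂ 𝔤 → Prop}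
    (one : P 1) (smul : ∀ (c : ℂ) ω, P ω → P (c • ω)) (add : ∀ ω η, P ω → P η → P (ω + η))
    (ι_mul : ∀ (x : 𝔤) ω, P ω → P (ExteriorAlgebra.ι ℂ x * ω)) (ω : ExteriorAlgebra ℂ 𝔤) : P ω :=
  CliffordAlgebra.left_induction (Q := (0 : QuadraticForm ℂ 𝔤))
    (fun c => by rw [Algebra.algebraMap_eq_smul_one]; exact smul c 1 one) add
    (fun ω x h => ι_mul x ω h) ω

lemma ι_mul_ι_swap (x y : 𝔤) : ExteriorAlgebra.ι ℂ x * ExteriorAlgebra.ι ℂ y =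
    -(ExteriorAlgebra.ι ℂ y * ExteriorAlgebra.ι ℂ x) :=
  eq_neg_of_add_eq_zero_left (ExteriorAlgebra.ι_add_mul_swap x y)

lemma contr_add (v w : Module.Dual ℂ 𝔤) (ω : ExteriorAlgebra ℂ 𝔤) :
    contr (v + w) ω = contr v ω + contr w ω :=
  congrArg (fun f => f ω) (map_add (CliffordAlgebra.contractLeft (Q := (0 : QuadraticForm ℂ 𝔤))) v w)

lemma contr_smul (c : ℂ) (v : Module.Dual ℂ 𝔤) (ω : ExteriorAlgebra ℂ 𝔤) :
    contr (c • v) ω = c • contr v ω :=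
  congrArg (fun f => f ω) (map_smul (CliffordAlgebra.contractLeft (Q := (0 : QuadraticForm ℂ 𝔤))) c v)

lemma contr_sum {κ : Type*} (s : Finset κ) (v : κ → Module.Dual ℂ 𝔤) (ω : ExteriorAlgebra ℂ 𝔤) :
    contr (∑ k ∈ s, v k) ω = ∑ k ∈ s, contr (v k) ω := by
  classical
  induction s using Finset.induction_on with
  | empty => simpa using contr_smul 0 (0 : Module.Dual ℂ 𝔤) ω
  | insert a s ha ih => rw [Finset.sum_insert ha, Finset.sum_insert ha, contr_add, ih]

lemma exteriorPower_induction {p : ℕ → ExteriorAlgebra ℂ 𝔤 → Prop}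
    (one : ∀ c, p 0 (algebraMap ℂ _ c)) (add : ∀ n ω η, p n ω → p n η → p n (ω + η))
    (ι_mul : ∀ n (x : 𝔤) ω, ω ∈ ⋀[ℂ]^n 𝔤 → p n ω → p (n + 1) (ExteriorAlgebra.ι ℂ x * ω))
    (n : ℕ) {ω : ExteriorAlgebra ℂ 𝔤} (hω : ω ∈ ⋀[ℂ]^n 𝔤) : p n ω := by
  induction n generalizing ω with
  | zero =>
    obtain ⟨c, rfl⟩ := Submodule.mem_one.1 (by simpa using hω)
    exact one c
  | succ n ih =>
    have h : ω ∈ LinearMap.range (ExteriorAlgebra.ι ℂ (M := 𝔤)) * ⋀[ℂ]^n 𝔤 := by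
      rw [← pow_succ']
      exact hω
    induction h using Submodule.mul_induction_on' with
    | mem_mul_mem a ha b hb =>
      obtain ⟨x, rfl⟩ := ha
      exact ι_mul n x b hb (ih hb)
    | add a ha b hb h1 h2 =>
      have e : LinearMap.range (ExteriorAlgebra.ι ℂ (M := 𝔤)) * ⋀[ℂ]^n 𝔤 = ⋀[ℂ]^(n + 1) 𝔤 :=
        (pow_succ' _ n).symm
      rw [e] at ha hb
      exact add _ _ _ (h1 ha) (h2 hb)

lemma algebraMap_mem_exteriorPower (c : ℂ) :
    algebraMap ℂ (ExteriorAlgebra ℂ 𝔤) c ∈ ⋀[ℂ]^0 𝔤 := by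
  exact (pow_zero (LinearMap.range (ExteriorAlgebra.ι ℂ (M := 𝔤)))).ge
    (Submodule.mem_one.2 ⟨c, rfl⟩)

lemma ι_mul_mem_exteriorPower {n : ℕ} (x : 𝔤) {ω : ExteriorAlgebra ℂ 𝔤} (hω : ω ∈ ⋀[ℂ]^n 𝔤) :
    ExteriorAlgebra.ι ℂ x * ω ∈ ⋀[ℂ]^(n + 1) 𝔤 := by
  exact (pow_succ' (LinearMap.range (ExteriorAlgebra.ι ℂ (M := 𝔤))) n).ge
    (Submodule.mul_mem_mul ⟨x, rfl⟩ hω)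

lemma contr_mem_exteriorPower {n : ℕ} (v : Module.Dual ℂ 𝔤) {ω : ExteriorAlgebra ℂ 𝔤}
    (hω : ω ∈ ⋀[ℂ]^(n + 1) 𝔤) : contr v ω ∈ ⋀[ℂ]^n 𝔤 := by
  -- Truncated subtraction sends degree 0 to 0, so the vanishing there is carried separately:
  -- multiplication by a vector would otherwise give a term of degree 1 instead of 0.
  refine exteriorPower_induction (𝔤 := 𝔤) (p := fun m ω => contr v ω ∈ ⋀[ℂ]^(m - 1) 𝔤 ∧
    (m = 0 → contr v ω = 0)) ?_ ?_ ?_ (n + 1) hω |>.1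
  · exact fun c => by simp [contr_algebraMap]
  · rintro m ω η ⟨h1, h2⟩ ⟨h3, h4⟩
    rw [map_add]
    exact ⟨add_mem h1 h3, fun h => by rw [h2 h, h4 h, add_zero]⟩
  · rintro m x ω hω ⟨h1, h2⟩
    refine ⟨?_, by simp⟩
    rw [contr_ι_mul]
    refine sub_mem (Submodule.smul_mem _ _ hω) ?_
    rcases m with _ | m
    · rw [h2 rfl, mul_zero]
      exact zero_mem _
    · exact ι_mul_mem_exteriorPower x h1

lemma map_mem_exteriorPower {𝔨 : Type*} [LieRing 𝔨] [LieAlgebra ℂ 𝔨] {n : ℕ} (f : 𝔤 →ₗ[ℂ] 𝔨)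
    {ω : ExteriorAlgebra ℂ 𝔤} (hω : ω ∈ ⋀[ℂ]^n 𝔤) :
    ExteriorAlgebra.map f ω ∈ ⋀[ℂ]^n 𝔨 := by
  refine exteriorPower_induction (𝔤 := 𝔤)
    (p := fun m ω => ExteriorAlgebra.map f ω ∈ ⋀[ℂ]^m 𝔨) ?_ ?_ ?_ n hω
  · intro c
    rw [AlgHom.commutes]
    exact algebraMap_mem_exteriorPower c
  · intro m ω η h1 h2
    rw [map_add]
    exact add_mem h1 h2
  · intro m x ω _ h
    rw [map_mul, ExteriorAlgebra.map_apply_ι]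
    exact ι_mul_mem_exteriorPower _ h

variable [FiniteDimensional ℂ 𝔤]

lemma derivExt_mem_exteriorPower {n : ℕ} (T : 𝔤 →ₗ[ℂ] 𝔤) {ω : ExteriorAlgebra ℂ 𝔤}
    (hω : ω ∈ ⋀[ℂ]^n 𝔤) : derivExt T ω ∈ ⋀[ℂ]^n 𝔤 := by
  refine exteriorPower_induction (𝔤 := 𝔤) (p := fun m ω => derivExt T ω ∈ ⋀[ℂ]^m 𝔤) ?_ ?_ ?_ n hω
  · intro c
    rw [derivExt_algebraMap]
    exact zero_mem _
  · intro m ω η h1 h2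
    rw [map_add]
    exact add_mem h1 h2
  · intro m x ω hω h
    rw [derivExt_ι_mul]
    exact add_mem (ι_mul_mem_exteriorPower _ hω) (ι_mul_mem_exteriorPower _ h)

lemma derivExt_add (S T : 𝔤 →ₗ[ℂ] 𝔤) (ω : ExteriorAlgebra ℂ 𝔤) :
    derivExt (S + T) ω = derivExt S ω + derivExt T ω := by
  simp [derivExt_apply, add_mul, Finset.sum_add_distrib]

lemma derivExt_smul (c : ℂ) (T : 𝔤 →ₗ[ℂ] 𝔤) (ω : ExteriorAlgebra ℂ 𝔤) :
    derivExt (c • T) ω = c • derivExt T ω := by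
  simp [derivExt_apply, Finset.smul_sum]

lemma derivExt_zero (ω : ExteriorAlgebra ℂ 𝔤) : derivExt 0 ω = 0 := by
  simp [derivExt_apply]

/-- The commutator of an odd and an even derivation is an odd derivation, so it is determined by its
values on vectors. -/
lemma contr_derivExt (v : Module.Dual ℂ 𝔤) (T : 𝔤 →ₗ[ℂ] 𝔤) (ω : ExteriorAlgebra ℂ 𝔤) :
    contr v (derivExt T ω) = derivExt T (contr v ω) + contr (v ∘ₗ T) ω := by
  induction ω using exteriorAlgebra_left_induction with
  | one => simp [derivExt_one, contr_one]
  | smul c ω h => simp [h]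
  | add ω η h1 h2 => simp only [map_add, h1, h2]; abel
  | ι_mul x ω h =>
    simp only [derivExt_ι_mul, contr_ι_mul, map_add, map_sub, map_smul, h, mul_add,
      LinearMap.comp_apply]
    abel

lemma derivExt_derivExt (S T : 𝔤 →ₗ[ℂ] 𝔤) (ω : ExteriorAlgebra ℂ 𝔤) :
    derivExt S (derivExt T ω) =
      derivExt (S ∘ₗ T - T ∘ₗ S) ω + derivExt T (derivExt S ω) := by
  induction ω using exteriorAlgebra_left_induction with
  | one => simp [derivExt_one]
  | smul c ω h => simp [h]
  | add ω η h1 h2 => simp only [map_add, h1, h2]; abel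
  | ι_mul x ω h =>
    simp only [derivExt_ι_mul, map_add, h, mul_add, LinearMap.sub_apply, LinearMap.comp_apply,
      map_sub, sub_mul]
    abel

lemma derivExt_map (f T T' : 𝔤 →ₗ[ℂ] 𝔤) (h : T ∘ₗ f = f ∘ₗ T') (ω : ExteriorAlgebra ℂ 𝔤) :
    derivExt T (ExteriorAlgebra.map f ω) = ExteriorAlgebra.map f (derivExt T' ω) := by
  have h' : ∀ x, T (f x) = f (T' x) := fun x => congrArg (fun g => g x) h
  induction ω using exteriorAlgebra_left_induction with
  | one => simp [derivExt_one]
  | smul c ω h => simp [h]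
  | add ω η h1 h2 => simp only [map_add, h1, h2]
  | ι_mul x ω h =>
    simp only [derivExt_ι_mul, map_mul, ExteriorAlgebra.map_apply_ι, map_add, h, h']

variable (𝔤) in
/-- The adjoint action of `𝔤` on its exterior algebra. -/
def adExt : 𝔤 →ₗ[ℂ] ExteriorAlgebra ℂ 𝔤 →ₗ[ℂ] ExteriorAlgebra ℂ 𝔤 where
  toFun x := derivExt (LieAlgebra.ad ℂ 𝔤 x)
  map_add' x y := LinearMap.ext fun ω => by simp [derivExt_add]
  map_smul' c x := LinearMap.ext fun ω => by simp [derivExt_smul]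

lemma adExt_apply (x : 𝔤) : adExt 𝔤 x = derivExt (LieAlgebra.ad ℂ 𝔤 x) := rfl

lemma adExt_ι_mul (x y : 𝔤) (ω : ExteriorAlgebra ℂ 𝔤) :
    adExt 𝔤 x (ExteriorAlgebra.ι ℂ y * ω) =
      ExteriorAlgebra.ι ℂ ⁅x, y⁆ * ω + ExteriorAlgebra.ι ℂ y * adExt 𝔤 x ω :=
  derivExt_ι_mul _ _ _

lemma adExt_ι (x y : 𝔤) : adExt 𝔤 x (ExteriorAlgebra.ι ℂ y) = ExteriorAlgebra.ι ℂ ⁅x, y⁆ :=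
  derivExt_ι _ _

lemma adExt_adExt (x y : 𝔤) (ω : ExteriorAlgebra ℂ 𝔤) :
    adExt 𝔤 x (adExt 𝔤 y ω) = adExt 𝔤 ⁅x, y⁆ ω + adExt 𝔤 y (adExt 𝔤 x ω) := by
  have h : LieAlgebra.ad ℂ 𝔤 ⁅x, y⁆ = LieAlgebra.ad ℂ 𝔤 x ∘ₗ LieAlgebra.ad ℂ 𝔤 y -
      LieAlgebra.ad ℂ 𝔤 y ∘ₗ LieAlgebra.ad ℂ 𝔤 x := by
    ext w
    simp
  rw [adExt_apply ⁅x, y⁆, h]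
  exact derivExt_derivExt _ _ _

/-- The eigenvectors of `T` with natural eigenvalues span the exterior algebra if they span `𝔤`, and
the projection to the zero eigenspace is the algebra morphism extending that of `𝔤`. -/
lemma span_derivExt_eigenvectors (T π : 𝔤 →ₗ[ℂ] 𝔤)
    (hspan : Submodule.span ℂ {x | ∃ k : ℕ, T x = (k : ℂ) • x ∧
      π x = (if (k : ℂ) = 0 then (1 : ℂ) else 0) • x} = ⊤) :
    Submodule.span ℂ {ω | ∃ k : ℕ, derivExt T ω = (k : ℂ) • ω ∧
      ExteriorAlgebra.map π ω = (if (k : ℂ) = 0 then (1 : ℂ) else 0) • ω} = ⊤ := by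
  set Q : Set (ExteriorAlgebra ℂ 𝔤) := {ω | ∃ k : ℕ, derivExt T ω = (k : ℂ) • ω ∧
      ExteriorAlgebra.map π ω = (if (k : ℂ) = 0 then (1 : ℂ) else 0) • ω} with hQ
  refine Submodule.eq_top_iff'.2 fun ω => ?_
  induction ω using exteriorAlgebra_left_induction with
  | one => exact Submodule.subset_span ⟨0, by simp [derivExt_one]⟩
  | smul c ω h => exact Submodule.smul_mem _ _ h
  | add ω η h1 h2 => exact add_mem h1 h2
  | ι_mul x ω h =>
    have hx := hspan.ge (Submodule.mem_top (x := x))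
    induction h using Submodule.span_induction with
    | zero => simp
    | add ω η _ _ h1 h2 => rw [mul_add]; exact add_mem h1 h2
    | smul c ω _ h => rw [mul_smul_comm]; exact Submodule.smul_mem _ _ h
    | mem ω hω =>
      induction hx using Submodule.span_induction with
      | zero => simp
      | add x y _ _ h1 h2 => rw [map_add, add_mul]; exact add_mem h1 h2
      | smul c x _ h => rw [map_smul, smul_mul_assoc]; exact Submodule.smul_mem _ _ h
      | mem x hx =>
        obtain ⟨k, hk1, hk2⟩ := hx
        obtain ⟨l, hl1, hl2⟩ := hω
        refine Submodule.subset_span ⟨k + l, ?_, ?_⟩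
        · rw [derivExt_ι_mul, hk1, hl1, map_smul, smul_mul_assoc, mul_smul_comm, ← add_smul]
          push_cast
          rfl
        · rw [map_mul, ExteriorAlgebra.map_apply_ι, hk2, hl2, map_smul, smul_mul_smul_comm]
          -- Eigenvalues are natural numbers, so they cannot cancel: k + l = 0 only when both
          -- vanish. This makes the zero eigenspace the subalgebra generated by the zero eigenspace
          -- of `T`.
          rcases k with _ | k
          · simp
          · have h1 : ((k + 1 : ℕ) : ℂ) ≠ 0 := Nat.cast_ne_zero.2 (by lia)
            have h2 : ((k + 1 + l : ℕ) : ℂ) ≠ 0 := Nat.cast_ne_zero.2 (by lia)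
            rw [if_neg h1, if_neg h2, zero_mul]

end ExteriorAlgebraLemmas

/-! ### The Casimir tensor of an invariant form and the twisted differential -/

section Casimir

variable {𝔤 : Type u} [LieRing 𝔤] [LieAlgebra ℂ 𝔤]

variable (𝔤) in
/-- The bracket as a bilinear map. -/
def bracket : 𝔤 →ₗ[ℂ] 𝔤 →ₗ[ℂ] 𝔤 := (LieAlgebra.ad ℂ 𝔤 : 𝔤 →ₗ[ℂ] Module.End ℂ 𝔤)

lemma bracket_apply (x y : 𝔤) : bracket 𝔤 x y = ⁅x, y⁆ := rfl

namespace InvForm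

variable (B : InvForm 𝔤)

lemma form_comm (x y : 𝔤) : B.form x y = B.form y x := B.symm.eq x y

lemma form_lie (x y z : 𝔤) : B.form ⁅x, y⁆ z = -B.form y ⁅x, z⁆ := B.invariant x y z

variable [FiniteDimensional ℂ 𝔤]

local notation "E" => Module.finBasis ℂ _


/-- The basis of `𝔤` dual to the chosen one with respect to an invariant form. -/
def dual : Module.Basis (Fin (Module.finrank ℂ 𝔤)) ℂ 𝔤 :=
  B.form.dualBasis B.nondegenerate (Module.finBasis ℂ 𝔤)

lemma coord_eq (a : Fin (Module.finrank ℂ 𝔤)) (x : 𝔤) :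
    (Module.finBasis ℂ 𝔤).coord a x = B.form (B.dual a) x := by
  have := LinearMap.BilinForm.dualBasis_repr_apply (B := B.form) B.nondegenerate B.dual x a
  rw [dual, LinearMap.BilinForm.dualBasis_dualBasis B.nondegenerate B.symm, B.form_comm] at this
  exact this

lemma sum_form_smul {M : Type*} [AddCommGroup M] [Module ℂ M] (g : 𝔤 →ₗ[ℂ] M) (x : 𝔤) :
    ∑ a, B.form (B.dual a) x • g (E a) = g x := by
  conv_rhs => rw [← (Module.finBasis ℂ 𝔤).sum_repr x]
  simp only [← B.coord_eq, Module.Basis.coord_apply, map_sum, map_smul]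

lemma sum_form_smul' {M : Type*} [AddCommGroup M] [Module ℂ M] (g : 𝔤 →ₗ[ℂ] M) (x : 𝔤) :
    ∑ a, B.form (E a) x • g (B.dual a) = g x := by
  conv_rhs => rw [← B.dual.sum_repr x]
  simp only [dual, LinearMap.BilinForm.dualBasis_repr_apply, B.form_comm x, map_sum, map_smul]

variable {A : Type*} [Ring A] [Algebra ℂ A] (f g : 𝔤 →ₗ[ℂ] A)

/-- The Casimir tensor ∑ E_a ⊗ E^a represents the form, so an operator passes from one factor to the
other as its adjoint. -/
lemma sum_mul_adjoint {T T' : 𝔤 →ₗ[ℂ] 𝔤} (h : ∀ x y, B.form (T x) y = B.form x (T' y)) :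
    ∑ a, f (T (E a)) * g (B.dual a) = ∑ a, f (E a) * g (T' (B.dual a)) := by
  have h1 : ∀ a, f (T (E a)) * g (B.dual a) =
      ∑ c, (B.form (B.dual c) (T (E a))) • (f (E c) * g (B.dual a)) := fun a => by
    rw [← B.sum_form_smul f (T (E a)), Finset.sum_mul]
    simp only [smul_mul_assoc]
  have h2 : ∀ c, f (E c) * g (T' (B.dual c)) =
      ∑ a, (B.form (E a) (T' (B.dual c))) • (f (E c) * g (B.dual a)) := fun c => by
    rw [← B.sum_form_smul' g (T' (B.dual c)), Finset.mul_sum]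
    simp only [mul_smul_comm]
  rw [Finset.sum_congr rfl fun a _ => h1 a, Finset.sum_congr rfl fun c _ => h2 c, Finset.sum_comm]
  simp only [B.form_comm (B.dual _), h]

lemma sum_mul_flip : ∑ a, f (E a) * g (B.dual a) = ∑ a, f (B.dual a) * g (E a) := by
  have h1 : ∀ a, f (E a) * g (B.dual a) =
      ∑ c, (B.form (E c) (E a)) • (f (B.dual c) * g (B.dual a)) := fun a => by
    rw [← B.sum_form_smul' f (E a), Finset.sum_mul]
    simp only [smul_mul_assoc]
  have h2 : ∀ c, f (B.dual c) * g (E c) =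
      ∑ a, (B.form (E a) (E c)) • (f (B.dual c) * g (B.dual a)) := fun c => by
    rw [← B.sum_form_smul' g (E c), Finset.mul_sum]
    simp only [mul_smul_comm]
  rw [Finset.sum_congr rfl fun a _ => h1 a, Finset.sum_congr rfl fun c _ => h2 c, Finset.sum_comm]
  exact Finset.sum_congr rfl fun c _ => Finset.sum_congr rfl fun a _ => by
    rw [B.form_comm (E c)]

/-- This is ad-invariance of the Casimir tensor: `ad x` is skew for the form. -/
lemma sum_lie_mul (x : 𝔤) :
    ∑ a, f ⁅x, E a⁆ * g (B.dual a) = -∑ a, f (E a) * g ⁅x, B.dual a⁆ := by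
  have := B.sum_mul_adjoint f g (T := LieAlgebra.ad ℂ 𝔤 x) (T' := -LieAlgebra.ad ℂ 𝔤 x)
    (fun y z => by
      rw [LinearMap.neg_apply, map_neg]
      exact B.form_lie x y z)
  simpa only [LinearMap.neg_apply, map_neg, mul_neg, Finset.sum_neg_distrib,
    LieAlgebra.ad_apply] using this

/-- The operator `∑ E_a ∧ ad (S E^a)` on the exterior algebra, where `(E_a)` and `(E^a)` are dual
bases. -/
def twistD (S : 𝔤 →ₗ[ℂ] 𝔤) : ExteriorAlgebra ℂ 𝔤 →ₗ[ℂ] ExteriorAlgebra ℂ 𝔤 :=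
  ∑ a, LinearMap.mulLeft ℂ (ExteriorAlgebra.ι ℂ (E a)) ∘ₗ adExt 𝔤 (S (B.dual a))

lemma twistD_apply (S : 𝔤 →ₗ[ℂ] 𝔤) (ω : ExteriorAlgebra ℂ 𝔤) :
    B.twistD S ω = ∑ a, ExteriorAlgebra.ι ℂ (E a) * adExt 𝔤 (S (B.dual a)) ω := by
  simp [twistD]

lemma twistD_mem_exteriorPower (S : 𝔤 →ₗ[ℂ] 𝔤) {n : ℕ} {ω : ExteriorAlgebra ℂ 𝔤}
    (hω : ω ∈ ⋀[ℂ]^n 𝔤) : B.twistD S ω ∈ ⋀[ℂ]^(n + 1) 𝔤 := by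
  rw [twistD_apply]
  exact Submodule.sum_mem _ fun a _ =>
    ι_mul_mem_exteriorPower _ (derivExt_mem_exteriorPower _ hω)

lemma twistD_one (S : 𝔤 →ₗ[ℂ] 𝔤) : B.twistD S 1 = 0 := by
  simp [twistD_apply, adExt_apply, derivExt_one]

/-- Each `ad (S E^a)` is an even derivation, and the left factor E_a changes sign when it passes x;
so the operator is an odd derivation. -/
lemma twistD_ι_mul (S : 𝔤 →ₗ[ℂ] 𝔤) (x : 𝔤) (ω : ExteriorAlgebra ℂ 𝔤) :
    B.twistD S (ExteriorAlgebra.ι ℂ x * ω) =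
      B.twistD S (ExteriorAlgebra.ι ℂ x) * ω - ExteriorAlgebra.ι ℂ x * B.twistD S ω := by
  simp only [twistD_apply, adExt_ι_mul, adExt_ι, Finset.sum_mul, Finset.mul_sum]
  rw [← Finset.sum_sub_distrib]
  refine Finset.sum_congr rfl fun a _ => ?_
  rw [mul_add, ← mul_assoc, ← mul_assoc, ← mul_assoc, ι_mul_ι_swap (E a) x, neg_mul, sub_eq_add_neg]

/-- `∑ E_a ∧ E_b ∧ g (u (E^a, E^b))`. -/
def double (u : 𝔤 →ₗ[ℂ] 𝔤 →ₗ[ℂ] 𝔤) (g : 𝔤 →ₗ[ℂ] ExteriorAlgebra ℂ 𝔤) : ExteriorAlgebra ℂ 𝔤 :=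
  ∑ a, ∑ b, ExteriorAlgebra.ι ℂ (E a) * (ExteriorAlgebra.ι ℂ (E b) *
    g (u (B.dual a) (B.dual b)))

lemma sum_sum_ι_mul_ι_mul_swap
    (F : Fin (Module.finrank ℂ 𝔤) → Fin (Module.finrank ℂ 𝔤) → ExteriorAlgebra ℂ 𝔤) :
    ∑ a, ∑ b, ExteriorAlgebra.ι ℂ (E a : 𝔤) * (ExteriorAlgebra.ι ℂ (E b) * F a b) =
      -∑ a, ∑ b, ExteriorAlgebra.ι ℂ (E a : 𝔤) * (ExteriorAlgebra.ι ℂ (E b) * F b a) := by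
  rw [Finset.sum_comm, ← Finset.sum_neg_distrib]
  refine Finset.sum_congr rfl fun a _ => ?_
  rw [← Finset.sum_neg_distrib]
  refine Finset.sum_congr rfl fun b _ => ?_
  rw [← mul_assoc, ι_mul_ι_swap, neg_mul, mul_assoc]

lemma double_flip (u : 𝔤 →ₗ[ℂ] 𝔤 →ₗ[ℂ] 𝔤) (g : 𝔤 →ₗ[ℂ] ExteriorAlgebra ℂ 𝔤) :
    B.double u.flip g = -B.double u g := by
  rw [eq_comm, neg_eq_iff_eq_neg]
  exact sum_sum_ι_mul_ι_mul_swap _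

lemma double_add (u v : 𝔤 →ₗ[ℂ] 𝔤 →ₗ[ℂ] 𝔤) (g : 𝔤 →ₗ[ℂ] ExteriorAlgebra ℂ 𝔤) :
    B.double (u + v) g = B.double u g + B.double v g := by
  simp [double, mul_add, Finset.sum_add_distrib]

lemma double_neg (u : 𝔤 →ₗ[ℂ] 𝔤 →ₗ[ℂ] 𝔤) (g : 𝔤 →ₗ[ℂ] ExteriorAlgebra ℂ 𝔤) :
    B.double (-u) g = -B.double u g := by
  simp [double]

/-- The vanishing of `∑ E_a ∧ E_b ∧ [x, [E^a, E^b]]`, which is the Jacobi identity. -/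
lemma double_bracket_ι (x : 𝔤) :
    B.double (bracket 𝔤) (ExteriorAlgebra.ι ℂ ∘ₗ LieAlgebra.ad ℂ 𝔤 x) = 0 := by
  set U := B.double (bracket 𝔤) (ExteriorAlgebra.ι ℂ ∘ₗ LieAlgebra.ad ℂ 𝔤 x)
  set V : ExteriorAlgebra ℂ 𝔤 := ∑ a, ∑ b, ExteriorAlgebra.ι ℂ (E a) *
    (ExteriorAlgebra.ι ℂ (E b) * ExteriorAlgebra.ι ℂ ⁅B.dual a, ⁅x, B.dual b⁆⁆)
  -- The Jacobi identity splits [x, [E^a, E^b]] into two terms, which contribute equally after a and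
  -- b are exchanged. Invariance of the Casimir tensor gives U = -V below, so 3U = 0.
  have h1 : U = V + V := by
    have e : U = V + ∑ a, ∑ b, ExteriorAlgebra.ι ℂ (E a) *
        (ExteriorAlgebra.ι ℂ (E b) * ExteriorAlgebra.ι ℂ (-⁅B.dual b, ⁅x, B.dual a⁆⁆)) := by
      simp only [U, V, double, ← Finset.sum_add_distrib, ← mul_add, ← map_add]
      refine Finset.sum_congr rfl fun a _ => Finset.sum_congr rfl fun b _ => ?_
      simp only [LinearMap.comp_apply, LieAlgebra.ad_apply, bracket_apply]
      rw [leibniz_lie x, lie_skew, add_comm]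
    rw [e, sum_sum_ι_mul_ι_mul_swap]
    simp only [V, map_neg, mul_neg, Finset.sum_neg_distrib, neg_neg]
  have h2 : U = -V := by
    -- The same sum is evaluated in two ways: here by moving `ad E^a` across the Casimir tensor and
    -- flipping the factors, in `e3` by moving `ad x`.
    have e : ∀ a, ∑ b, ExteriorAlgebra.ι ℂ ⁅x, E b⁆ * ExteriorAlgebra.ι ℂ ⁅B.dual a, B.dual b⁆ =
        ∑ b, ExteriorAlgebra.ι ℂ (E b) * ExteriorAlgebra.ι ℂ ⁅x, ⁅B.dual a, B.dual b⁆⁆ := fun a => by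
      have e1 := B.sum_lie_mul (ExteriorAlgebra.ι ℂ ∘ₗ LieAlgebra.ad ℂ 𝔤 x)
        (ExteriorAlgebra.ι ℂ) (B.dual a)
      have e2 := B.sum_mul_flip (ExteriorAlgebra.ι ℂ ∘ₗ LieAlgebra.ad ℂ 𝔤 x ∘ₗ
        LieAlgebra.ad ℂ 𝔤 (B.dual a)) (ExteriorAlgebra.ι ℂ)
      simp only [LinearMap.comp_apply, LieAlgebra.ad_apply] at e1 e2
      rw [eq_neg_iff_add_eq_zero, add_comm, ← eq_neg_iff_add_eq_zero] at e1
      rw [e1, e2, ← Finset.sum_neg_distrib]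
      exact Finset.sum_congr rfl fun b _ => by rw [ι_mul_ι_swap, neg_neg]
    have e3 : ∀ a, ∑ b, ExteriorAlgebra.ι ℂ ⁅x, E b⁆ * ExteriorAlgebra.ι ℂ ⁅B.dual a, B.dual b⁆ =
        -∑ b, ExteriorAlgebra.ι ℂ (E b) * ExteriorAlgebra.ι ℂ ⁅B.dual a, ⁅x, B.dual b⁆⁆ := fun a =>
      B.sum_lie_mul (ExteriorAlgebra.ι ℂ) (ExteriorAlgebra.ι ℂ ∘ₗ LieAlgebra.ad ℂ 𝔤 (B.dual a)) x
    simp only [U, V, double, LinearMap.comp_apply, LieAlgebra.ad_apply, bracket_apply,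
      ← Finset.mul_sum]
    rw [← Finset.sum_neg_distrib]
    exact Finset.sum_congr rfl fun a _ => by rw [← e, e3, mul_neg]
  have h3 : (3 : ℂ) • U = 0 := by
    have : V = -U := by rw [h2, neg_neg]
    rw [this] at h1
    have h4 : U + U + U = 0 := by
      nth_rewrite 1 [h1]
      abel
    rw [← h4]
    module
  exact (smul_eq_zero.1 h3).resolve_left (by norm_num)

/-- A derivation is a combination of contractions. Here the coefficient of the k-th contraction is,
up to sign, the sum of `double_bracket_ι` at x = E_k. -/
lemma double_bracket (ω : ExteriorAlgebra ℂ 𝔤) :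
    B.double (bracket 𝔤) ((adExt 𝔤).flip ω) = 0 := by
  have h : ∀ k, ∑ a, ∑ b, ExteriorAlgebra.ι ℂ (E a) * (ExteriorAlgebra.ι ℂ (E b) *
      ExteriorAlgebra.ι ℂ ⁅⁅B.dual a, B.dual b⁆, E k⁆) = 0 := fun k => by
    have := B.double_bracket_ι (E k)
    simp only [double, LinearMap.comp_apply, LieAlgebra.ad_apply, bracket_apply] at this
    simp only [← lie_skew _ (E k), map_neg, mul_neg, Finset.sum_neg_distrib, this, neg_zero]
  have e : B.double (bracket 𝔤) ((adExt 𝔤).flip ω) =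
      ∑ k, (∑ a, ∑ b, ExteriorAlgebra.ι ℂ (E a) * (ExteriorAlgebra.ι ℂ (E b) *
        ExteriorAlgebra.ι ℂ ⁅⁅B.dual a, B.dual b⁆, E k⁆)) *
          contr ((Module.finBasis ℂ 𝔤).coord k) ω := by
    simp only [double, bracket_apply, LinearMap.flip_apply, adExt_apply, derivExt_apply,
      Finset.mul_sum, Finset.sum_mul, LieAlgebra.ad_apply, mul_assoc]
    rw [Finset.sum_congr rfl fun a _ => Finset.sum_comm, Finset.sum_comm]
  rw [e]
  simp only [h, zero_mul, Finset.sum_const_zero]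

/-- The square of `∑ E_a ∧ ad (S E^a)`, for an operator `S` which satisfies a modified classical
Yang--Baxter equation. -/
lemma twistD_twistD {S π : 𝔤 →ₗ[ℂ] 𝔤}
    (hYB : ∀ x y, ⁅S x, S y⁆ - S ⁅S x, y⁆ - S ⁅x, S y⁆ = -⁅x, y⁆ + ⁅π x, π y⁆)
    {ω : ExteriorAlgebra ℂ 𝔤} (hω : ∀ x y, adExt 𝔤 ⁅π x, π y⁆ ω = 0) :
    B.twistD S (B.twistD S ω) = 0 := by
  set g := (adExt 𝔤).flip ω with hg
  set v : 𝔤 →ₗ[ℂ] 𝔤 →ₗ[ℂ] 𝔤 := ((bracket 𝔤) ∘ₗ S).compr₂ S with hv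
  set w : 𝔤 →ₗ[ℂ] 𝔤 →ₗ[ℂ] 𝔤 := (bracket 𝔤).compl₁₂ S S with hw
  set Y : ExteriorAlgebra ℂ 𝔤 := ∑ a, ∑ b, ExteriorAlgebra.ι ℂ (E a) *
    (ExteriorAlgebra.ι ℂ (E b) * adExt 𝔤 (S (B.dual a)) (adExt 𝔤 (S (B.dual b)) ω)) with hY
  -- The outer adjoint action hits either E_b or the inner adjoint action. Invariance of the Casimir
  -- tensor turns the first contribution into S[S E^a, E^b]; the second is Y.
  have h1 : B.twistD S (B.twistD S ω) = -B.double v g + Y := by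
    have e : ∀ a, ExteriorAlgebra.ι ℂ (E a) * adExt 𝔤 (S (B.dual a))
        (∑ b, ExteriorAlgebra.ι ℂ (E b) * adExt 𝔤 (S (B.dual b)) ω) =
        -(∑ b, ExteriorAlgebra.ι ℂ (E a) * (ExteriorAlgebra.ι ℂ (E b) *
          g (v (B.dual a) (B.dual b)))) +
        ∑ b, ExteriorAlgebra.ι ℂ (E a) * (ExteriorAlgebra.ι ℂ (E b) *
          adExt 𝔤 (S (B.dual a)) (adExt 𝔤 (S (B.dual b)) ω)) := fun a => by
      have e1 : ∑ b, ExteriorAlgebra.ι ℂ ⁅S (B.dual a), E b⁆ * adExt 𝔤 (S (B.dual b)) ω =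
          -∑ b, ExteriorAlgebra.ι ℂ (E b) * adExt 𝔤 (S ⁅S (B.dual a), B.dual b⁆) ω :=
        B.sum_lie_mul (ExteriorAlgebra.ι ℂ) ((adExt 𝔤).flip ω ∘ₗ S) (S (B.dual a))
      simp only [map_sum, adExt_ι_mul, Finset.sum_add_distrib, mul_add, e1, mul_neg]
      simp only [Finset.mul_sum, hg, hv, LinearMap.flip_apply, LinearMap.compr₂_apply,
        LinearMap.comp_apply, bracket_apply]
    rw [twistD_apply, twistD_apply, Finset.sum_congr rfl fun a _ => e a, Finset.sum_add_distrib,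
      Finset.sum_neg_distrib]
    rfl
  -- Since E_a ∧ E_b is antisymmetric, only the commutator of the two adjoint actions matters.
  have h2 : Y = B.double w g - Y := by
    have e : Y = B.double w g + ∑ a, ∑ b, ExteriorAlgebra.ι ℂ (E a) *
        (ExteriorAlgebra.ι ℂ (E b) * adExt 𝔤 (S (B.dual b)) (adExt 𝔤 (S (B.dual a)) ω)) := by
      simp only [hY, double, ← Finset.sum_add_distrib, ← mul_add]
      refine Finset.sum_congr rfl fun a _ => Finset.sum_congr rfl fun b _ => ?_
      rw [adExt_adExt]
      rfl
    nth_rewrite 1 [e]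
    rw [sum_sum_ι_mul_ι_mul_swap, ← sub_eq_add_neg]
  -- Flipping v changes the sign of its sum, so 2d²ω is the sum for w - v + v.flip, which is the
  -- Yang–Baxter expression of S.
  have h3 : B.double (w - v + v.flip) g = 0 := by
    have e : w - v + v.flip = -bracket 𝔤 + (bracket 𝔤).compl₁₂ π π := by
      ext x y
      have := hYB x y
      simp only [hw, hv, LinearMap.add_apply, LinearMap.sub_apply, LinearMap.compl₁₂_apply,
        bracket_apply, LinearMap.compr₂_apply, LinearMap.comp_apply, LinearMap.flip_apply,
        LinearMap.neg_apply]
      rw [← this, ← lie_skew x (S y), map_neg]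
      abel
    rw [e, double_add, double_neg, double_bracket, neg_zero, zero_add]
    simp [double, bracket_apply, hg, hω]
  have h4 : (2 : ℂ) • B.twistD S (B.twistD S ω) = 0 := by
    rw [← h3, sub_eq_add_neg, double_add, double_add, double_neg, double_flip, h1, two_smul]
    nth_rewrite 1 [h2]
    abel
  exact (smul_eq_zero.1 h4).resolve_left (by norm_num)

/-- Invariance of the Casimir tensor cancels the two terms in which `ad x` acts on E_a and on S E^a.
-/
lemma adExt_twistD {S : 𝔤 →ₗ[ℂ] 𝔤} {x : 𝔤} (hx : ∀ y, S ⁅x, y⁆ = ⁅x, S y⁆)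
    (ω : ExteriorAlgebra ℂ 𝔤) :
    adExt 𝔤 x (B.twistD S ω) = B.twistD S (adExt 𝔤 x ω) := by
  have e1 : ∑ b, ExteriorAlgebra.ι ℂ ⁅x, E b⁆ * adExt 𝔤 (S (B.dual b)) ω =
      -∑ b, ExteriorAlgebra.ι ℂ (E b) * adExt 𝔤 (S ⁅x, B.dual b⁆) ω :=
    B.sum_lie_mul (ExteriorAlgebra.ι ℂ) ((adExt 𝔤).flip ω ∘ₗ S) x
  simp only [twistD_apply, map_sum, adExt_ι_mul, Finset.sum_add_distrib, e1, adExt_adExt x, mul_add,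
    hx]
  abel

/-- The commuting skew operators `ad x` and S have a self-adjoint product, so ∑ E_a ⊗ [x, S E^a] is
a symmetric tensor and dies in ⋀². -/
lemma twistD_ι_eq_zero {S : 𝔤 →ₗ[ℂ] 𝔤} (hS : ∀ x y, B.form (S x) y = -B.form x (S y)) {x : 𝔤}
    (hx : ∀ y, S ⁅x, y⁆ = ⁅x, S y⁆) : B.twistD S (ExteriorAlgebra.ι ℂ x) = 0 := by
  set v : ExteriorAlgebra ℂ 𝔤 :=
    ∑ a, ExteriorAlgebra.ι ℂ (E a) * ExteriorAlgebra.ι ℂ ⁅x, S (B.dual a)⁆ with hv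
  have h1 : B.twistD S (ExteriorAlgebra.ι ℂ x) = -v := by
    simp only [twistD_apply, adExt_ι, hv, ← Finset.sum_neg_distrib]
    exact Finset.sum_congr rfl fun a _ => by rw [← lie_skew, map_neg, mul_neg]
  have h2 : v = -v := by
    have e1 := B.sum_mul_adjoint (ExteriorAlgebra.ι ℂ) (ExteriorAlgebra.ι ℂ)
      (T := LieAlgebra.ad ℂ 𝔤 x ∘ₗ S) (T' := LieAlgebra.ad ℂ 𝔤 x ∘ₗ S) (fun y z => by
        simp only [LinearMap.comp_apply, LieAlgebra.ad_apply]
        rw [B.form_lie, hS, neg_neg, hx])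
    have e2 := B.sum_mul_flip (ExteriorAlgebra.ι ℂ ∘ₗ LieAlgebra.ad ℂ 𝔤 x ∘ₗ S)
      (ExteriorAlgebra.ι ℂ)
    simp only [LinearMap.comp_apply, LieAlgebra.ad_apply] at e1 e2
    nth_rewrite 1 [hv]
    rw [← e1, e2, hv, ← Finset.sum_neg_distrib]
    exact Finset.sum_congr rfl fun b _ => ι_mul_ι_swap _ _
  have h3 : (2 : ℂ) • v = 0 := by
    rw [two_smul]
    nth_rewrite 1 [h2]
    abel
  rw [h1, (smul_eq_zero.1 h3).resolve_left (by norm_num), neg_zero]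

lemma twistD_map {S π : 𝔤 →ₗ[ℂ] 𝔤} (h : ∀ x, B.twistD S (ExteriorAlgebra.ι ℂ (π x)) = 0)
    (ω : ExteriorAlgebra ℂ 𝔤) : B.twistD S (ExteriorAlgebra.map π ω) = 0 := by
  induction ω using exteriorAlgebra_left_induction with
  | one => rw [map_one, twistD_one]
  | smul c ω h => rw [map_smul, map_smul, h, smul_zero]
  | add ω η h1 h2 => rw [map_add, map_add, h1, h2, add_zero]
  | ι_mul x ω h' =>
    rw [map_mul, ExteriorAlgebra.map_apply_ι, twistD_ι_mul, h, h', zero_mul, mul_zero, sub_zero]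

/-- The self-adjoint π applied to E_a can be moved to the argument of S, where Sπ = 0. This is why
no coboundary survives the projection. -/
lemma map_twistD {S π : 𝔤 →ₗ[ℂ] 𝔤} (hπ : ∀ x y, B.form (π x) y = B.form x (π y))
    (h : ∀ x, S (π x) = 0) (ω : ExteriorAlgebra ℂ 𝔤) :
    ExteriorAlgebra.map π (B.twistD S ω) = 0 := by
  have := B.sum_mul_adjoint (ExteriorAlgebra.ι ℂ)
    ((ExteriorAlgebra.map π).toLinearMap ∘ₗ (adExt 𝔤).flip ω ∘ₗ S) hπ
  simp only [LinearMap.comp_apply, h, map_zero, mul_zero, Finset.sum_const_zero] at this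
  rw [twistD_apply, map_sum, ← this]
  exact Finset.sum_congr rfl fun a _ => by
    rw [map_mul, ExteriorAlgebra.map_apply_ι]
    rfl

/-- A Cartan-type homotopy formula. Contracting the factors E_a yields the adjoint action of S z =
0; what remains is the commutator of the contraction with the `ad (S E^a)`, again a sum of
contractions by `contr_derivExt`. Invariance of the form and skewness of S reassemble it into a
derivation. -/
lemma contr_twistD {S : 𝔤 →ₗ[ℂ] 𝔤} (hS : ∀ x y, B.form (S x) y = -B.form x (S y)) {z : 𝔤}
    (hz : S z = 0) (ω : ExteriorAlgebra ℂ 𝔤) :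
    contr (B.form z) (B.twistD S ω) + B.twistD S (contr (B.form z) ω) =
      -derivExt (S ∘ₗ LieAlgebra.ad ℂ 𝔤 z) ω := by
  have h1 : ∑ a, B.form z (E a) • adExt 𝔤 (S (B.dual a)) ω = 0 := by
    have := B.sum_form_smul' ((adExt 𝔤).flip ω ∘ₗ S) z
    simp only [LinearMap.comp_apply, hz, map_zero, LinearMap.flip_apply] at this
    rw [← this]
    exact Finset.sum_congr rfl fun a _ => by rw [B.form_comm z]
  have h2 : ∀ v : Module.Dual ℂ 𝔤,
      contr v ω = ∑ k, v (E k) • contr ((Module.finBasis ℂ 𝔤).coord k) ω := fun v => by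
    simp only [← contr_smul, ← contr_sum]
    refine congrArg (fun v => contr v ω) ?_
    exact ((Module.finBasis ℂ 𝔤).sum_dual_apply_smul_coord v).symm
  have h3 : ∑ a, ExteriorAlgebra.ι ℂ (E a) *
      contr (B.form z ∘ₗ LieAlgebra.ad ℂ 𝔤 (S (B.dual a))) ω =
        derivExt (S ∘ₗ LieAlgebra.ad ℂ 𝔤 z) ω := by
    have e : ∀ x, ∑ a, B.form z ⁅S (B.dual a), x⁆ • ExteriorAlgebra.ι ℂ (E a) =
        ExteriorAlgebra.ι ℂ (S ⁅z, x⁆) := fun x => by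
      rw [← B.sum_form_smul (ExteriorAlgebra.ι ℂ) (S ⁅z, x⁆)]
      refine Finset.sum_congr rfl fun a _ => ?_
      congr 1
      have e1 := B.form_lie (S (B.dual a)) z x
      have e2 := B.form_lie z (S (B.dual a)) x
      have e3 := hS (B.dual a) ⁅z, x⁆
      rw [← lie_skew, map_neg, LinearMap.neg_apply] at e1
      linear_combination e1 + e2 - e3
    simp only [h2 (B.form z ∘ₗ _), Finset.mul_sum, LinearMap.comp_apply, LieAlgebra.ad_apply,
      mul_smul_comm]
    rw [Finset.sum_comm, derivExt_apply]
    refine Finset.sum_congr rfl fun k _ => ?_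
    rw [LinearMap.comp_apply, LieAlgebra.ad_apply, ← e, Finset.sum_mul]
    simp only [smul_mul_assoc]
  rw [← h3]
  simp only [adExt_apply] at h1
  simp only [twistD_apply, map_sum, contr_ι_mul, Finset.sum_sub_distrib, h1, adExt_apply,
    contr_derivExt, mul_add, Finset.sum_add_distrib]
  abel

end InvForm

end Casimir

/-! ### The sign operator of a grading and the homotopy argument -/

section Graded

variable {𝔤 : Type u} [LieRing 𝔤] [LieAlgebra ℂ 𝔤]

/-- `ad z` is diagonalisable with integral eigenvalues, and `S` acts on its eigenspaces by the
opposite of the sign of the eigenvalue. -/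
structure IsSignOperator (z : 𝔤) (S : 𝔤 →ₗ[ℂ] 𝔤) : Prop where
  span_eq_top : Submodule.span ℂ {x : 𝔤 | ∃ k : ℤ, ⁅z, x⁆ = (k : ℂ) • x} = ⊤
  apply_eq : ∀ (k : ℤ) (x : 𝔤), ⁅z, x⁆ = (k : ℂ) • x → S x = -((k.sign : ℤ) : ℂ) • x

namespace IsSignOperator

variable {z : 𝔤} {S : 𝔤 →ₗ[ℂ] 𝔤} (h : IsSignOperator z S)
include h

lemma induction {p : 𝔤 → Prop} (zero : p 0) (add : ∀ x y, p x → p y → p (x + y))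
    (smul : ∀ (c : ℂ) x, p x → p (c • x))
    (eigen : ∀ (k : ℤ) (x : 𝔤), ⁅z, x⁆ = (k : ℂ) • x → p x) (x : 𝔤) : p x := by
  have hx := h.span_eq_top.ge (Submodule.mem_top (x := x))
  induction hx using Submodule.span_induction with
  | zero => exact zero
  | add x y _ _ h1 h2 => exact add x y h1 h2
  | smul c x _ h => exact smul c x h
  | mem x hx =>
    obtain ⟨k, hk⟩ := hx
    exact eigen k x hk

/-- Linear maps which agree on the eigenvectors of `ad z` are equal. -/
lemma linearMap_ext {M : Type*} [AddCommGroup M] [Module ℂ M] {f g : 𝔤 →ₗ[ℂ] M}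
    (hfg : ∀ (k : ℤ) (x : 𝔤), ⁅z, x⁆ = (k : ℂ) • x → f x = g x) : f = g := by
  ext x
  induction x using h.induction with
  | zero => simp
  | add x y h1 h2 => simp [h1, h2]
  | smul c x h => simp [h]
  | eigen k x hk => exact hfg k x hk

lemma bilin_ext {M : Type*} [AddCommGroup M] [Module ℂ M] {f g : 𝔤 →ₗ[ℂ] 𝔤 →ₗ[ℂ] M}
    (hfg : ∀ (k l : ℤ) (x y : 𝔤), ⁅z, x⁆ = (k : ℂ) • x → ⁅z, y⁆ = (l : ℂ) • y →
      f x y = g x y) : f = g :=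
  h.linearMap_ext fun k x hx => h.linearMap_ext fun l y hy => hfg k l x y hx hy

omit h in
lemma lie_lie_eq_smul {k l : ℤ} {x y : 𝔤} (hx : ⁅z, x⁆ = (k : ℂ) • x) (hy : ⁅z, y⁆ = (l : ℂ) • y) :
    ⁅z, ⁅x, y⁆⁆ = ((k + l : ℤ) : ℂ) • ⁅x, y⁆ := by
  rw [leibniz_lie, hx, hy, smul_lie, lie_smul, ← add_smul]
  push_cast
  rfl

lemma apply_of_lie_eq_zero {x : 𝔤} (hx : ⁅z, x⁆ = 0) : S x = 0 := by
  simpa using h.apply_eq 0 x (by simpa using hx)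

/-- By invariance the form pairs the eigenspace of k only with that of -k, and the sign function is
odd. -/
lemma form_apply (B : InvForm 𝔤) (x y : 𝔤) : B.form (S x) y = -B.form x (S y) := by
  have : B.form ∘ₗ S = -B.form.compl₂ S := by
    refine h.bilin_ext fun k l x y hx hy => ?_
    simp only [LinearMap.comp_apply, LinearMap.neg_apply, LinearMap.compl₂_apply,
      h.apply_eq k x hx, h.apply_eq l y hy, map_smul, LinearMap.smul_apply, smul_eq_mul]
    have h1 := B.form_lie z x y
    rw [hx, hy, map_smul, map_smul, LinearMap.smul_apply, smul_eq_mul, smul_eq_mul] at h1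
    have h2 : ((k + l : ℤ) : ℂ) * B.form x y = 0 := by
      push_cast
      linear_combination h1
    rcases mul_eq_zero.1 h2 with h3 | h3
    · have h4 : l = -k := by
        have : k + l = 0 := by exact_mod_cast h3
        lia
      rw [h4, Int.sign_neg]
      push_cast
      ring
    · rw [h3, mul_zero, mul_zero, neg_zero]
  exact LinearMap.congr_fun₂ this x y

lemma lie_comm {x : 𝔤} (hx : ⁅z, x⁆ = 0) (y : 𝔤) : S ⁅x, y⁆ = ⁅x, S y⁆ := by
  have : S ∘ₗ LieAlgebra.ad ℂ 𝔤 x = LieAlgebra.ad ℂ 𝔤 x ∘ₗ S := by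
    refine h.linearMap_ext fun k y hy => ?_
    have h1 := lie_lie_eq_smul (z := z) (k := 0) (l := k) (x := x) (y := y) (by simpa using hx) hy
    rw [zero_add] at h1
    simp only [LinearMap.comp_apply, LieAlgebra.ad_apply, h.apply_eq k _ h1, h.apply_eq k y hy,
      lie_smul]
  exact LinearMap.congr_fun this y

/-- The projection to the centraliser of `z`. -/
lemma proj_apply_eq (k : ℤ) (x : 𝔤) (hx : ⁅z, x⁆ = (k : ℂ) • x) :
    (LinearMap.id - S ∘ₗ S : 𝔤 →ₗ[ℂ] 𝔤) x = (if k = 0 then (1 : ℂ) else 0) • x := by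
  simp only [LinearMap.sub_apply, LinearMap.id_apply, LinearMap.comp_apply, h.apply_eq k x hx,
    map_smul, smul_smul]
  rcases lt_trichotomy k 0 with hk | rfl | hk
  · simp [Int.sign_eq_neg_one_of_neg hk, hk.ne]
  · simp
  · simp [Int.sign_eq_one_of_pos hk, hk.ne']

lemma proj_of_lie_eq_zero {x : 𝔤} (hx : ⁅z, x⁆ = 0) :
    (LinearMap.id - S ∘ₗ S : 𝔤 →ₗ[ℂ] 𝔤) x = x := by
  simp [h.apply_of_lie_eq_zero hx]

lemma lie_proj (x : 𝔤) : ⁅z, (LinearMap.id - S ∘ₗ S : 𝔤 →ₗ[ℂ] 𝔤) x⁆ = 0 := by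
  have : LieAlgebra.ad ℂ 𝔤 z ∘ₗ (LinearMap.id - S ∘ₗ S : 𝔤 →ₗ[ℂ] 𝔤) = 0 := by
    refine h.linearMap_ext fun k x hx => ?_
    rw [LinearMap.comp_apply, h.proj_apply_eq k x hx, LieAlgebra.ad_apply, lie_smul, hx]
    split_ifs with hk <;> simp [hk]
  exact LinearMap.congr_fun this x

lemma form_proj (B : InvForm 𝔤) (x y : 𝔤) :
    B.form ((LinearMap.id - S ∘ₗ S : 𝔤 →ₗ[ℂ] 𝔤) x) y =
      B.form x ((LinearMap.id - S ∘ₗ S : 𝔤 →ₗ[ℂ] 𝔤) y) := by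
  simp [h.form_apply B]

lemma yangBaxter (x y : 𝔤) :
    ⁅S x, S y⁆ - S ⁅S x, y⁆ - S ⁅x, S y⁆ = -⁅x, y⁆ +
      ⁅(LinearMap.id - S ∘ₗ S : 𝔤 →ₗ[ℂ] 𝔤) x, (LinearMap.id - S ∘ₗ S : 𝔤 →ₗ[ℂ] 𝔤) y⁆ := by
  set π : 𝔤 →ₗ[ℂ] 𝔤 := LinearMap.id - S ∘ₗ S with hπ
  have : (bracket 𝔤).compl₁₂ S S - ((bracket 𝔤) ∘ₗ S).compr₂ S - ((bracket 𝔤).compl₂ S).compr₂ S =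
      -bracket 𝔤 + (bracket 𝔤).compl₁₂ π π := by
    refine h.bilin_ext fun k l x y hx hy => ?_
    have h1 := lie_lie_eq_smul hx hy
    simp only [LinearMap.add_apply, LinearMap.sub_apply, LinearMap.compl₁₂_apply, bracket_apply,
      LinearMap.compr₂_apply, LinearMap.comp_apply, LinearMap.compl₂_apply, LinearMap.neg_apply,
      hπ ▸ h.proj_apply_eq k x hx, hπ ▸ h.proj_apply_eq l y hy, h.apply_eq k x hx,
      h.apply_eq l y hy, map_smul, LinearMap.smul_apply, h.apply_eq _ _ h1, smul_smul, ← sub_smul]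
    rw [← neg_one_smul ℂ ⁅x, y⁆, ← add_smul]
    congr 1
    -- With s the sign function, the claim is s(k)s(l) - s(k+l)(s(k)+s(l)) = -1 + δ_{k,0} δ_{l,0}.
    -- For opposite signs s(k)+s(l) = 0, so the undetermined s(k+l) drops out.
    rcases lt_trichotomy k 0 with hk | rfl | hk <;> rcases lt_trichotomy l 0 with hl | rfl | hl
    · simp [Int.sign_eq_neg_one_of_neg hk, Int.sign_eq_neg_one_of_neg hl,
        Int.sign_eq_neg_one_of_neg (add_neg hk hl), hk.ne, hl.ne]
    · simp [Int.sign_eq_neg_one_of_neg hk, hk.ne]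
    · simp [Int.sign_eq_neg_one_of_neg hk, Int.sign_eq_one_of_pos hl, hk.ne, hl.ne']
    · simp [Int.sign_eq_neg_one_of_neg hl, hl.ne]
    · simp
    · simp [Int.sign_eq_one_of_pos hl, hl.ne']
    · simp [Int.sign_eq_one_of_pos hk, Int.sign_eq_neg_one_of_neg hl, hk.ne', hl.ne]
    · simp [Int.sign_eq_one_of_pos hk, hk.ne']
    · simp [Int.sign_eq_one_of_pos hk, Int.sign_eq_one_of_pos hl,
        Int.sign_eq_one_of_pos (add_pos hk hl), hk.ne', hl.ne']
  exact LinearMap.congr_fun₂ this x y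

variable [FiniteDimensional ℂ 𝔤]

/-- The exterior algebra is spanned by eigenvectors of the derivation extending `|ad z|`. -/
lemma span_derivExt_eigenvectors :
    Submodule.span ℂ {ω | ∃ k : ℕ, derivExt (-(S ∘ₗ LieAlgebra.ad ℂ 𝔤 z)) ω = (k : ℂ) • ω ∧
      ExteriorAlgebra.map (LinearMap.id - S ∘ₗ S) ω =
        (if (k : ℂ) = 0 then (1 : ℂ) else 0) • ω} = ⊤ := by
  refine RelTwist.span_derivExt_eigenvectors _ _ (eq_top_iff.2 ?_)
  rw [← h.span_eq_top]
  refine Submodule.span_mono ?_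
  rintro x ⟨k, hk⟩
  refine ⟨k.natAbs, ?_, ?_⟩
  · rw [LinearMap.neg_apply, LinearMap.comp_apply, LieAlgebra.ad_apply, hk, map_smul,
      h.apply_eq k x hk, smul_smul, ← neg_smul]
    congr 1
    have : (k.natAbs : ℤ) = k.sign * k := by rw [Int.sign_mul_self_eq_abs, Int.natCast_natAbs]
    rw [← Int.cast_natCast, this]
    push_cast
    ring
  · rw [h.proj_apply_eq k x hk]
    simp

lemma iSup_eigenspace_derivExt :
    ⨆ μ, Module.End.eigenspace (derivExt (-(S ∘ₗ LieAlgebra.ad ℂ 𝔤 z))) μ = ⊤ := by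
  rw [eq_top_iff, ← h.span_derivExt_eigenvectors, Submodule.span_le]
  rintro ω ⟨k, h1, -⟩
  exact Submodule.mem_iSup_of_mem (k : ℂ) (Module.End.mem_eigenspace_iff.2 h1)

/-- On a spanning set of eigenvectors of N the projection is 1 for the eigenvalue 0 and 0 otherwise;
`apply_eq_smul_of_span_eigenvectors` carries this to the whole kernel. -/
lemma map_proj_of_derivExt_eq_zero {ω : ExteriorAlgebra ℂ 𝔤}
    (hω : derivExt (-(S ∘ₗ LieAlgebra.ad ℂ 𝔤 z)) ω = 0) :
    ExteriorAlgebra.map (LinearMap.id - S ∘ₗ S) ω = ω := by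
  have h1 := apply_eq_smul_of_span_eigenvectors
    (A := derivExt (-(S ∘ₗ LieAlgebra.ad ℂ 𝔤 z)))
    (B := (ExteriorAlgebra.map (LinearMap.id - S ∘ₗ S)).toLinearMap)
    (s := fun μ => if μ = 0 then 1 else 0) (x := ω) (μ := 0) ?_ (by rw [hω, zero_smul])
  · simpa using h1
  · rw [eq_top_iff, ← h.span_derivExt_eigenvectors]
    refine Submodule.span_mono ?_
    rintro η ⟨k, h1, h2⟩
    exact ⟨k, h1, h2⟩

variable (B : InvForm 𝔤) {𝔰 : LieSubalgebra ℂ 𝔤} (hz : ∀ x ∈ 𝔰, ⁅z, x⁆ = 0)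
include hz

lemma twistD_mem_invariants {ω : ExteriorAlgebra ℂ 𝔤} (hω : ω ∈ invariants 𝔰) :
    B.twistD S ω ∈ invariants 𝔰 := by
  rw [mem_invariants] at hω ⊢
  intro x hx
  have := B.adExt_twistD (h.lie_comm (hz x hx)) ω
  rw [adExt_apply, hω x hx, map_zero] at this
  exact this

-- For x in 𝔰 the form (z, ·) vanishes on [x, 𝔤], because x centralises z; so the contraction
-- commutes with `ad x`.
omit h in
lemma contr_mem_invariants {ω : ExteriorAlgebra ℂ 𝔤} (hω : ω ∈ invariants 𝔰) :
    contr (B.form z) ω ∈ invariants 𝔰 := by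
  rw [mem_invariants] at hω ⊢
  intro x hx
  have h1 := contr_derivExt (B.form z) (LieAlgebra.ad ℂ 𝔤 x) ω
  have h2 : B.form z ∘ₗ LieAlgebra.ad ℂ 𝔤 x = (0 : ℂ) • B.form z := by
    ext y
    have := B.form_lie x z y
    rw [← lie_skew, hz x hx, neg_zero, map_zero, LinearMap.zero_apply] at this
    simpa using neg_eq_zero.1 this.symm
  rw [hω x hx, map_zero, h2, contr_smul, zero_smul, add_zero] at h1
  exact h1.symm

lemma derivExt_mem_invariants {ω : ExteriorAlgebra ℂ 𝔤} (hω : ω ∈ invariants 𝔰) :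
    derivExt (-(S ∘ₗ LieAlgebra.ad ℂ 𝔤 z)) ω ∈ invariants 𝔰 := by
  rw [mem_invariants] at hω ⊢
  intro x hx
  rw [derivExt_derivExt, hω x hx, map_zero, add_zero]
  have h2 : LieAlgebra.ad ℂ 𝔤 x ∘ₗ (-(S ∘ₗ LieAlgebra.ad ℂ 𝔤 z)) -
      (-(S ∘ₗ LieAlgebra.ad ℂ 𝔤 z)) ∘ₗ LieAlgebra.ad ℂ 𝔤 x = 0 := by
    ext y
    simp only [LinearMap.sub_apply, LinearMap.comp_apply, LinearMap.neg_apply, LieAlgebra.ad_apply,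
      lie_neg, LinearMap.zero_apply]
    rw [leibniz_lie z x y, hz x hx, zero_lie, zero_add, h.lie_comm (hz x hx)]
    abel
  rw [h2, derivExt_zero]

variable (hs : ∀ x y : 𝔤, ⁅z, x⁆ = 0 → ⁅z, y⁆ = 0 → ⁅x, y⁆ ∈ 𝔰)
include hs

/-- `⟦r, ·⟧` is a differential on the invariants of `𝔰`. -/
lemma isCochainDatum : IsCochainDatum (invPart 𝔰) (B.twistD S) where
  map_mem _ _ hω := ⟨B.twistD_mem_exteriorPower S hω.1, h.twistD_mem_invariants B hz hω.2⟩
  sq_zero _ _ hω := B.twistD_twistD h.yangBaxter fun x y =>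
    mem_invariants.1 hω.2 _ (hs _ _ (h.lie_proj x) (h.lie_proj y))

omit hz hs in
lemma contr_twistD_add (ω : ExteriorAlgebra ℂ 𝔤) :
    contr (B.form z) (B.twistD S ω) + B.twistD S (contr (B.form z) ω) =
      derivExt (-(S ∘ₗ LieAlgebra.ad ℂ 𝔤 z)) ω := by
  rw [B.contr_twistD (h.form_apply B) (h.apply_of_lie_eq_zero (lie_self z)), ← neg_one_smul ℂ
    (S ∘ₗ LieAlgebra.ad ℂ 𝔤 z), derivExt_smul, neg_one_smul]

/-- A cocycle is the sum of an element of the exterior algebra of the centraliser of `z` and of the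
coboundary of an element given by contraction with `z`. -/
lemma exists_add_twistD_contr_eq {n : ℕ} {ω : ExteriorAlgebra ℂ 𝔤} (hω : ω ∈ invPart 𝔰 n)
    (hd : B.twistD S ω = 0) : ∃ v ∈ invPart 𝔰 n,
      ExteriorAlgebra.map (LinearMap.id - S ∘ₗ S) v = v ∧
        ∃ η ∈ invPart 𝔰 n, v + B.twistD S (contr (B.form z) η) = ω := by
  set N := derivExt (-(S ∘ₗ LieAlgebra.ad ℂ 𝔤 z)) with hN
  -- On invariant cocycles the homotopy formula reduces to d ι_z = N. As d² = 0 on invariants, N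
  -- preserves them, so the cocycle splits into eigenvectors of N that are again invariant cocycles.
  let Z : Submodule ℂ (ExteriorAlgebra ℂ 𝔤) := invPart 𝔰 n ⊓ LinearMap.ker (B.twistD S)
  have hZ : ∀ η ∈ Z, B.twistD S (contr (B.form z) η) = N η := fun η hη => by
    rw [hN, ← h.contr_twistD_add B, LinearMap.mem_ker.1 hη.2, map_zero, zero_add]
  have stable : ∀ η ∈ Z, N η ∈ Z := by
    intro η hη
    refine ⟨⟨derivExt_mem_exteriorPower _ hη.1.1, h.derivExt_mem_invariants hz hη.1.2⟩, ?_⟩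
    change B.twistD S (N η) = 0
    rw [← hZ η hη]
    exact B.twistD_twistD h.yangBaxter fun x y =>
      mem_invariants.1 (contr_mem_invariants B hz hη.1.2) _ (hs _ _ (h.lie_proj x) (h.lie_proj y))
  have : FiniteDimensional ℂ (ExteriorAlgebra ℂ 𝔤) :=
    Module.Finite.of_basis (Module.finBasis ℂ 𝔤).ExteriorAlgebra
  have hsup := Submodule.inf_iSup_genEigenspace stable 1
  have htop : ⨆ μ, Module.End.genEigenspace N μ 1 = ⊤ := h.iSup_eigenspace_derivExt
  rw [htop, inf_top_eq] at hsup
  have hωZ : ω ∈ Z := ⟨hω, hd⟩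
  rw [hsup] at hωZ
  induction hωZ using Submodule.iSup_induction' with
  | zero => exact ⟨0, zero_mem _, map_zero _, 0, zero_mem _, by simp⟩
  | add ω₁ ω₂ h1 h2 ih1 ih2 =>
    rw [← hsup] at h1 h2
    obtain ⟨v₁, hv₁, hP₁, η₁, hη₁, e₁⟩ := ih1 h1.1 h1.2
    obtain ⟨v₂, hv₂, hP₂, η₂, hη₂, e₂⟩ := ih2 h2.1 h2.2
    refine ⟨v₁ + v₂, add_mem hv₁ hv₂, by rw [map_add, hP₁, hP₂], η₁ + η₂, add_mem hη₁ hη₂, ?_⟩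
    rw [map_add, map_add, ← e₁, ← e₂]
    abel
  | mem μ ω hωμ =>
    have hE : N ω = μ • ω := Module.End.mem_eigenspace_iff.1 hωμ.2
    by_cases hμ : μ = 0
    · rw [hμ, zero_smul] at hE
      exact ⟨ω, hωμ.1.1, h.map_proj_of_derivExt_eq_zero hE, 0, zero_mem _, by simp⟩
    -- Here ω = d(ι_z(μ⁻¹ω)). The witness is the element before contraction, of degree n, so that n
    -- = 0 needs no predecessor.
    · refine ⟨0, zero_mem _, map_zero _, μ⁻¹ • ω, Submodule.smul_mem _ _ hωμ.1.1, ?_⟩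
      rw [map_smul, map_smul, hZ ω hωμ.1, hE, smul_smul, inv_mul_cancel₀ hμ, one_smul, zero_add]

omit hz hs in
lemma twistD_eq_zero_of_map_proj {ω : ExteriorAlgebra ℂ 𝔤}
    (hω : ExteriorAlgebra.map (LinearMap.id - S ∘ₗ S) ω = ω) : B.twistD S ω = 0 := by
  rw [← hω]
  exact B.twistD_map (fun x => B.twistD_ι_eq_zero (h.form_apply B) (h.lie_comm (h.lie_proj x))) ω

omit hz hs in
lemma map_proj_twistD (ω : ExteriorAlgebra ℂ 𝔤) :
    ExteriorAlgebra.map (LinearMap.id - S ∘ₗ S) (B.twistD S ω) = 0 :=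
  B.map_twistD (h.form_proj B) (fun x => h.apply_of_lie_eq_zero (h.lie_proj x)) ω

/-- The inclusion of the invariant elements of the exterior algebra of the centraliser of `z` is a
quasi-isomorphism. -/
lemma quasiIso_subComplexIncl {V : ℕ → Submodule ℂ (ExteriorAlgebra ℂ 𝔤)}
    (hV : ∀ n ω, ω ∈ V n ↔ ω ∈ invPart 𝔰 n ∧
      ExteriorAlgebra.map (LinearMap.id - S ∘ₗ S) ω = ω)
    (h₀ : IsCochainDatum V 0) (h₁ : IsCochainDatum (invPart 𝔰) (B.twistD S))
    (hle : ∀ n, V n ≤ invPart 𝔰 n)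
    (hd : ∀ n, ∀ ω ∈ V n, (0 : ExteriorAlgebra ℂ 𝔤 →ₗ[ℂ] ExteriorAlgebra ℂ 𝔤) ω = B.twistD S ω) :
    QuasiIso (subComplexIncl h₀ h₁ hle hd) := by
  refine quasiIso_subComplexIncl_of_zero h₀ h₁ hle hd ?_ ?_ ?_
  -- A coboundary fixed by the projection is also killed by it, hence zero.
  · intro n η _ hη
    have := ((hV _ _).1 hη).2
    rw [h.map_proj_twistD B] at this
    exact this.symm
  · intro ω hω hd
    obtain ⟨v, hv, hP, η, hη, e⟩ := h.exists_add_twistD_contr_eq B hz hs hω hd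
    obtain ⟨c, rfl⟩ := Submodule.mem_one.1 (by simpa using hη.1)
    rw [contr_algebraMap, map_zero, add_zero] at e
    exact (hV _ _).2 ⟨hω, e ▸ hP⟩
  · intro n ω hω hd
    obtain ⟨v, hv, hP, η, hη, e⟩ := h.exists_add_twistD_contr_eq B hz hs hω hd
    exact ⟨v, (hV _ _).2 ⟨hv, hP⟩, contr (B.form z) η,
      ⟨contr_mem_exteriorPower _ hη.1, contr_mem_invariants B hz hη.2⟩, e⟩

end IsSignOperator

end Graded

/-! ### Root spaces, the grading element and the Levi subalgebra -/

section Roots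

open LieAlgebra LieAlgebra.IsKilling LieModule

variable {𝔤 : Type u} [LieRing 𝔤] [LieAlgebra ℂ 𝔤] [FiniteDimensional ℂ 𝔤]
  {H : LieSubalgebra ℂ 𝔤} [H.IsCartanSubalgebra]

/-- `𝔤` is spanned by `H` and the root spaces. -/
lemma rootSpace_induction {p : 𝔤 → Prop} (add : ∀ x y, p x → p y → p (x + y))
    (cartan : ∀ x ∈ H, p x) (root : ∀ α : H.root, ∀ x ∈ rootSpace H α.1, p x) (x : 𝔤) : p x := by
  have hx : x ∈ (⨆ χ : Weight ℂ H 𝔤, rootSpace H χ : LieSubmodule ℂ H 𝔤) := by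
    rw [LieModule.iSup_genWeightSpace_eq_top' ℂ H 𝔤]
    trivial
  induction hx using LieSubmodule.iSup_induction' with
  | zero => exact cartan 0 (zero_mem _)
  | add x y _ _ h1 h2 => exact add x y h1 h2
  | mem χ x hx =>
    by_cases hχ : χ.IsZero
    · refine cartan x ?_
      have h0 : x ∈ rootSpace H (0 : H → ℂ) := by rwa [show (χ : H → ℂ) = 0 from hχ] at hx
      rwa [rootSpace_zero_eq] at h0
    · exact root ⟨χ, by simpa using hχ⟩ x hx

lemma rootSpace_le_diagSubalgebra {α : H.root} {D : Set H.root} (hα : α ∈ D) {x : 𝔤}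
    (hx : x ∈ rootSpace H α.1) :
    x ∈ diagSubalgebra D :=
  LieSubalgebra.subset_lieSpan ⟨α, hα, Or.inl hx⟩

lemma rootSpace_neg_le_diagSubalgebra {α : H.root} {D : Set H.root} (hα : α ∈ D) {x : 𝔤}
    (hx : x ∈ rootSpace H (-α.1 : H → ℂ)) : x ∈ diagSubalgebra D :=
  LieSubalgebra.subset_lieSpan ⟨α, hα, Or.inr hx⟩

/-- The centraliser of an element. -/
def centralizerOf (z : 𝔤) : LieSubalgebra ℂ 𝔤 where
  __ := LinearMap.ker (LieAlgebra.ad ℂ 𝔤 z)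
  lie_mem' {x y} hx hy := by
    have hx' : ⁅z, x⁆ = 0 := hx
    have hy' : ⁅z, y⁆ = 0 := hy
    change ⁅z, ⁅x, y⁆⁆ = 0
    rw [leibniz_lie, hx', hy', zero_lie, lie_zero, add_zero]

variable [LieAlgebra.IsSemisimple ℂ 𝔤]

lemma lie_of_mem_rootSpace {χ : H → ℂ} {x : 𝔤} (hx : x ∈ rootSpace H χ) (h : H) :
    ⁅(h : 𝔤), x⁆ = χ h • x :=
  lie_eq_smul_of_mem_rootSpace hx h

lemma lie_cartan {x y : 𝔤} (hx : x ∈ H) (hy : y ∈ H) : ⁅x, y⁆ = 0 :=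
  congrArg Subtype.val (trivial_lie_zero H H ⟨x, hx⟩ ⟨y, hy⟩)

lemma exists_smul_eq_of_mem_rootSpace {α : Weight ℂ H 𝔤} (hα : α.IsNonZero) {x y : 𝔤}
    (hx : x ∈ rootSpace H α) (hx0 : x ≠ 0) (hy : y ∈ rootSpace H α) : ∃ c : ℂ, c • x = y := by
  obtain ⟨c, hc⟩ := (finrank_eq_one_iff_of_nonzero' (⟨x, hx⟩ : rootSpace H α)
    (by simpa using hx0)).mp (finrank_rootSpace_eq_one α hα) ⟨y, hy⟩
  exact ⟨c, congrArg Subtype.val hc⟩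

/-- If `α`, `β` and `α + β` are roots then `[𝔤_α, 𝔤_β]` is not zero. -/
lemma exists_lie_ne_zero {α β γ : Weight ℂ H 𝔤} (hα : α.IsNonZero)
    (hγ : (γ : H → ℂ) = α + β) : ∃ x ∈ rootSpace H α, ∃ y ∈ rootSpace H β, ⁅x, y⁆ ≠ 0 := by
  -- With x a highest weight vector of the α-string through β, the second factor is f^(m+1) x of
  -- weight β, where m + 1 is the distance to the top. Then [e, f^(m+1) x] is (m + 1)(chain length -
  -- m) times f^m x, and both are nonzero.
  obtain ⟨x, hx, x_ne0⟩ := (chainTop α β).exists_ne_zero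
  obtain ⟨h, e, f, isSl2, he, hf⟩ := exists_isSl2Triple_of_weight_isNonZero hα
  obtain rfl := isSl2.h_eq_coroot hα he hf
  have prim : isSl2.HasPrimitiveVectorWith x (chainLength α β : ℂ) :=
    have := lie_mem_genWeightSpace_of_mem_genWeightSpace he hx
    ⟨x_ne0, (chainLength_smul _ _ hx).symm, by rwa [genWeightSpace_add_chainTop _ _ hα] at this⟩
  have hn1 : 1 ≤ chainTopCoeff α β := by
    have h1 : rootSpace H ((1 : ℤ) • (α : H → ℂ) + β) ≠ ⊥ := by
      rw [one_smul, ← hγ]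
      exact γ.genWeightSpace_ne_bot
    exact_mod_cast ((rootSpace_zsmul_add_ne_bot_iff α β hα 1).1 h1).1
  have hn2 := chainTopCoeff_le_chainLength α β
  obtain ⟨m, hm⟩ : ∃ m, chainTopCoeff α β = m + 1 := ⟨chainTopCoeff α β - 1, by lia⟩
  refine ⟨e, he, ((toEnd ℂ 𝔤 𝔤 f) ^ (m + 1)) x, ?_, ?_⟩
  · have := toEnd_pow_apply_mem hf hx (m + 1)
    convert this using 2
    rw [← hm, coe_chainTop]
    ext t
    simp
  · rw [prim.lie_e_pow_succ_toEnd_f]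
    refine smul_ne_zero (mul_ne_zero (by exact_mod_cast (Nat.succ_ne_zero m)) ?_)
      (prim.pow_toEnd_f_ne_zero_of_eq_nat rfl (by lia))
    rw [sub_ne_zero]
    exact_mod_cast (show chainLength α β ≠ m by lia)

/-- The root space of γ is a line, so it is spanned by one nonzero bracket of root vectors of α and
β. -/
lemma rootSpace_le_of_add {K : LieSubalgebra ℂ 𝔤} {α β γ : Weight ℂ H 𝔤} (hα : α.IsNonZero)
    (hγ0 : γ.IsNonZero) (hγ : (γ : H → ℂ) = α + β) (h1 : ∀ x ∈ rootSpace H α, x ∈ K)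
    (h2 : ∀ x ∈ rootSpace H β, x ∈ K) : ∀ x ∈ rootSpace H γ, x ∈ K := by
  obtain ⟨x, hx, y, hy, hxy⟩ := exists_lie_ne_zero hα hγ
  intro w hw
  have h3 : ⁅x, y⁆ ∈ rootSpace H γ := by
    rw [hγ]
    exact lie_mem_genWeightSpace_of_mem_genWeightSpace hx hy
  obtain ⟨c, rfl⟩ := exists_smul_eq_of_mem_rootSpace hγ0 h3 hxy hw
  exact K.smul_mem c (K.lie_mem (h1 x hx) (h2 y hy))

/-! ### The subalgebra attached to a set of simple roots -/

variable (b : (rootSystem H).Base) {D : Set H.root}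

/-- The element of `H` on which the simple roots in `D` vanish and the other ones are `1`. -/
lemma exists_grading_element (D : Set H.root) :
    ∃ z : H, (∀ α ∈ b.support, α ∈ D → α.1 z = 0) ∧ (∀ α ∈ b.support, α ∉ D → α.1 z = 1) := by
  classical
  -- The simple roots are a basis of H*, so their values can be prescribed; the bidual
  -- identification turns the functional into an element of H.
  let φ : Module.Dual ℂ (Module.Dual ℂ H) :=
    b.toWeightBasis.constr ℂ fun α => if (α : H.root) ∈ D then (0 : ℂ) else 1
  have h : ∀ α : b.support, α.1.1 ((Module.evalEquiv ℂ H).symm φ) =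
      if (α : H.root) ∈ D then (0 : ℂ) else 1 := fun α => by
    have h1 := Module.apply_evalEquiv_symm_apply ℂ H ((rootSystem H).root α) φ
    rw [← b.toWeightBasis_apply, Module.Basis.constr_basis, b.toWeightBasis_apply] at h1
    exact h1
  exact ⟨(Module.evalEquiv ℂ H).symm φ, fun α hα hD => by rw [h ⟨α, hα⟩, if_pos hD],
    fun α hα hD => by rw [h ⟨α, hα⟩, if_neg hD]⟩

/-- The centraliser of z is a subalgebra that contains H and the generators of 𝔤_D. It serves for
the grading element and for the centre of 𝔩_D. -/
lemma lie_eq_zero_of_mem_levi {z : 𝔤} (hz : z ∈ H) (hzD : ∀ α ∈ D, α.1 ⟨z, hz⟩ = 0) {x : 𝔤}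
    (hx : x ∈ levi D) : ⁅z, x⁆ = 0 := by
  have h1 : levi D ≤ centralizerOf z := by
    refine sup_le (LieSubalgebra.lieSpan_le.2 ?_) fun x hx => lie_cartan hz hx
    rintro x ⟨α, hα, hx | hx⟩
    · exact (lie_of_mem_rootSpace hx ⟨z, hz⟩).trans (by rw [hzD α hα, zero_smul])
    · exact (lie_of_mem_rootSpace hx ⟨z, hz⟩).trans
        (by rw [Pi.neg_apply, hzD α hα, neg_zero, zero_smul])
  exact h1 hx

lemma exists_neg_root (α : H.root) : ∃ β : H.root, (β.1 : H → ℂ) = -α.1 ∧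
    (b.IsPos β ↔ ¬ b.IsPos α) := by
  let := (rootSystem H).indexNeg
  have h : (rootSystem H).root (-α) = -(rootSystem H).root α :=
    ((rootSystem H).root_reflectionPerm α α).trans (RootPairing.reflection_apply_self _ _)
  refine ⟨-α, ?_, RootPairing.Base.IsPos.neg_iff_not b α⟩
  ext t
  exact congrArg (fun φ : Module.Dual ℂ H => φ t) h

variable {b}

/-- Positive roots take natural values on the grading element, and `𝔤_D` contains the root spaces
`𝔤_{±α}` for the positive roots `α` which vanish on it. -/
lemma exists_nat_of_isPos {z : H} (h0 : ∀ α ∈ b.support, α ∈ D → α.1 z = 0)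
    (h1 : ∀ α ∈ b.support, α ∉ D → α.1 z = 1) {α : H.root} (hα : b.IsPos α) :
    (∃ n : ℕ, α.1 z = n) ∧ (α.1 z = 0 → (∀ x ∈ rootSpace H α.1, x ∈ diagSubalgebra D) ∧
      ∀ x ∈ rootSpace H (-α.1 : H → ℂ), x ∈ diagSubalgebra D) := by
  have simple : ∀ α ∈ b.support, (∃ n : ℕ, α.1 z = n) ∧ (α.1 z = 0 →
      (∀ x ∈ rootSpace H α.1, x ∈ diagSubalgebra D) ∧
      ∀ x ∈ rootSpace H (-α.1 : H → ℂ), x ∈ diagSubalgebra D) := by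
    intro α hα
    by_cases hαD : α ∈ D
    · exact ⟨⟨0, by rw [h0 α hα hαD]; simp⟩, fun _ =>
        ⟨fun x hx => rootSpace_le_diagSubalgebra hαD hx,
          fun x hx => rootSpace_neg_le_diagSubalgebra hαD hx⟩⟩
    · exact ⟨⟨1, by rw [h1 α hα hαD]; simp⟩, fun h => by
        rw [h1 α hα hαD] at h
        exact absurd h one_ne_zero⟩
  refine hα.induction_on_add simple ?_
  rintro α β γ hγ ⟨⟨n, hn⟩, ih⟩ hβ
  obtain ⟨⟨m, hm⟩, ih'⟩ := simple β hβ
  have hγ' : (γ.1 : H → ℂ) = α.1 + β.1 := by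
    ext t
    exact congrArg (fun φ : Module.Dual ℂ H => φ t) hγ
  have hz : γ.1 z = ((n + m : ℕ) : ℂ) := by
    rw [hγ', Pi.add_apply, hn, hm]
    push_cast
    rfl
  refine ⟨⟨n + m, hz⟩, fun h => ?_⟩
  -- Natural values cannot cancel, so both summands of a root vanishing at z vanish at z, and
  -- induction applies to each.
  have hnm : n + m = 0 := by exact_mod_cast hz.symm.trans h
  have hα0 := ih (by rw [hn, show n = 0 by lia]; simp)
  have hβ0 := ih' (by rw [hm, show m = 0 by lia]; simp)
  refine ⟨rootSpace_le_of_add (H.isNonZero_coe_root α) (H.isNonZero_coe_root γ) hγ' hα0.1 hβ0.1, ?_⟩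
  obtain ⟨α', hα', -⟩ := exists_neg_root b α
  obtain ⟨β', hβ', -⟩ := exists_neg_root b β
  obtain ⟨γ', hγ'', -⟩ := exists_neg_root b γ
  rw [← hγ'']
  refine rootSpace_le_of_add (H.isNonZero_coe_root α') (H.isNonZero_coe_root γ')
    (show (γ'.1 : H → ℂ) = α'.1 + β'.1 by rw [hγ'', hγ', hα', hβ', neg_add]) ?_ ?_
  · rw [hα']
    exact hα0.2
  · rw [hβ']
    exact hβ0.2

/-- One direction holds because 𝔤_D centralises z, the other is the inductive construction of root
spaces from simple ones. Thus the roots left in r_𝔤 - r_D are the positive roots of positive degree.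
-/
lemma mem_diagRoots_iff_of_isPos (hD : D ⊆ b.support) {z : H}
    (h0 : ∀ α ∈ b.support, α ∈ D → α.1 z = 0) (h1 : ∀ α ∈ b.support, α ∉ D → α.1 z = 1)
    {α : H.root} (hα : b.IsPos α) : α ∈ diagRoots D ↔ α.1 z = 0 := by
  refine ⟨fun h => ?_, fun h => ((exists_nat_of_isPos h0 h1 hα).2 h).1⟩
  obtain ⟨x, hx, hx0⟩ := α.1.exists_ne_zero
  have h2 : ⁅(z : 𝔤), x⁆ = 0 := lie_eq_zero_of_mem_levi z.2 (fun β hβ => h0 β (hD hβ) hβ)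
    ((le_sup_left : diagSubalgebra D ≤ levi D) (h x hx))
  rw [lie_of_mem_rootSpace hx z] at h2
  exact (smul_eq_zero.1 h2).resolve_right hx0

lemma exists_int_root_apply {z : H} (h0 : ∀ α ∈ b.support, α ∈ D → α.1 z = 0)
    (h1 : ∀ α ∈ b.support, α ∉ D → α.1 z = 1) (α : H.root) : ∃ k : ℤ, α.1 z = k := by
  by_cases hpos : b.IsPos α
  · obtain ⟨n, hn⟩ := (exists_nat_of_isPos h0 h1 hpos).1
    exact ⟨n, by rw [hn, Int.cast_natCast]⟩
  · obtain ⟨β, hβ, hβpos⟩ := exists_neg_root b α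
    obtain ⟨n, hn⟩ := (exists_nat_of_isPos h0 h1 (hβpos.2 hpos)).1
    refine ⟨-n, ?_⟩
    rw [hβ, Pi.neg_apply] at hn
    rw [Int.cast_neg, Int.cast_natCast, ← hn, neg_neg]

lemma mem_levi_of_mem_rootSpace {z : H} (h0 : ∀ α ∈ b.support, α ∈ D → α.1 z = 0)
    (h1 : ∀ α ∈ b.support, α ∉ D → α.1 z = 1) {α : H.root} (hα : α.1 z = 0) {x : 𝔤}
    (hx : x ∈ rootSpace H α.1) : x ∈ levi D := by
  refine (le_sup_left : diagSubalgebra D ≤ levi D) ?_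
  by_cases hpos : b.IsPos α
  · exact ((exists_nat_of_isPos h0 h1 hpos).2 hα).1 x hx
  · obtain ⟨β, hβ, hβpos⟩ := exists_neg_root b α
    have hβz : β.1 z = 0 := by rw [hβ, Pi.neg_apply, hα, neg_zero]
    refine ((exists_nat_of_isPos h0 h1 (hβpos.2 hpos)).2 hβz).2 x ?_
    rwa [hβ, neg_neg]

/-- The Levi subalgebra `𝔩_D` is the image of the projection to the centraliser of the grading
element. -/
lemma IsSignOperator.proj_mem_levi {z : H} {S : 𝔤 →ₗ[ℂ] 𝔤} (h : IsSignOperator (z : 𝔤) S)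
    (h0 : ∀ α ∈ b.support, α ∈ D → α.1 z = 0)
    (h1 : ∀ α ∈ b.support, α ∉ D → α.1 z = 1) (x : 𝔤) :
    (LinearMap.id - S ∘ₗ S : 𝔤 →ₗ[ℂ] 𝔤) x ∈ levi D := by
  induction x using rootSpace_induction (H := H) with
  | add x y hx hy => rw [map_add]; exact add_mem hx hy
  | cartan x hx =>
    rw [h.proj_of_lie_eq_zero (lie_cartan z.2 hx)]
    exact (le_sup_right : H ≤ levi D) hx
  | root α x hx =>
    obtain ⟨k, hk⟩ := exists_int_root_apply h0 h1 α
    rw [h.proj_apply_eq k x (by rw [lie_of_mem_rootSpace hx z, hk])]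
    by_cases hk0 : k = 0
    · rw [if_pos hk0, one_smul]
      exact mem_levi_of_mem_rootSpace h0 h1 (by rw [hk, hk0, Int.cast_zero]) hx
    · rw [if_neg hk0, zero_smul]
      exact zero_mem _

end Roots

/-! ### The operator attached to r_𝔤 - r_D -/

section SignOperator

open LieAlgebra LieAlgebra.IsKilling LieModule

variable {𝔤 : Type u} [LieRing 𝔤] [LieAlgebra ℂ 𝔤] [FiniteDimensional ℂ 𝔤]

lemma schouten_ι_mul_ι (x y : 𝔤) (ω : ExteriorAlgebra ℂ 𝔤) :
    schouten (ExteriorAlgebra.ι ℂ x * ExteriorAlgebra.ι ℂ y) ω =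
      ExteriorAlgebra.ι ℂ x * adExt 𝔤 y ω - ExteriorAlgebra.ι ℂ y * adExt 𝔤 x ω := by
  have key : ∀ x y : 𝔤, ExteriorAlgebra.ι ℂ x * adExt 𝔤 y ω = -∑ b, ∑ a,
      ExteriorAlgebra.ι ℂ ⁅Module.finBasis ℂ 𝔤 a, Module.finBasis ℂ 𝔤 b⁆ *
        ((Module.finBasis ℂ 𝔤).coord a y • ExteriorAlgebra.ι ℂ x) *
          contr ((Module.finBasis ℂ 𝔤).coord b) ω := by
    intro x y
    rw [adExt_apply, derivExt_apply, Finset.mul_sum, ← Finset.sum_neg_distrib]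
    refine Finset.sum_congr rfl fun b _ => ?_
    have h := sum_coord_smul_ι (-LieAlgebra.ad ℂ 𝔤 (Module.finBasis ℂ 𝔤 b)) y
    simp only [LinearMap.neg_apply, LieAlgebra.ad_apply, lie_skew] at h
    simp_rw [mul_smul_comm, ← smul_mul_assoc]
    rw [← Finset.sum_mul, ← Finset.sum_mul, h, ι_mul_ι_swap, neg_mul, neg_neg, mul_assoc,
      LieAlgebra.ad_apply]
  rw [schouten_apply, Finset.sum_comm, key x y, key y x, ← Finset.sum_neg_distrib,
    ← Finset.sum_neg_distrib, ← Finset.sum_sub_distrib]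
  refine Finset.sum_congr rfl fun b _ => ?_
  rw [← Finset.sum_neg_distrib, ← Finset.sum_neg_distrib, ← Finset.sum_sub_distrib]
  refine Finset.sum_congr rfl fun a _ => ?_
  have h : contr ((Module.finBasis ℂ 𝔤).coord a)
      (ExteriorAlgebra.ι ℂ x * ExteriorAlgebra.ι ℂ y) =
      (Module.finBasis ℂ 𝔤).coord a x • ExteriorAlgebra.ι ℂ y -
        (Module.finBasis ℂ 𝔤).coord a y • ExteriorAlgebra.ι ℂ x := by
    have h1 := contr_ι_mul ((Module.finBasis ℂ 𝔤).coord a) y 1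
    rw [mul_one, contr_one, mul_zero, sub_zero] at h1
    rw [contr_ι_mul, h1, mul_smul_comm, mul_one]
  rw [h, mul_sub, sub_mul]
  abel

variable [LieAlgebra.IsSemisimple ℂ 𝔤] {H : LieSubalgebra ℂ 𝔤} [H.IsCartanSubalgebra]

namespace InvForm

variable (B : InvForm 𝔤)

lemma form_eq_zero_of_mem_rootSpace {χ ψ : H → ℂ} {x y : 𝔤} (hx : x ∈ rootSpace H χ)
    (hy : y ∈ rootSpace H ψ) (h : χ + ψ ≠ 0) : B.form x y = 0 := by
  obtain ⟨t, ht⟩ : ∃ t : H, χ t + ψ t ≠ 0 := by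
    by_contra hcon
    push Not at hcon
    exact h (funext hcon)
  have h1 := B.form_lie (t : 𝔤) x y
  rw [lie_of_mem_rootSpace hx, lie_of_mem_rootSpace hy, map_smul, map_smul, LinearMap.smul_apply,
    smul_eq_mul, smul_eq_mul] at h1
  exact (mul_eq_zero.1 (show (χ t + ψ t) * B.form x y = 0 by linear_combination h1)).resolve_left ht

/-- If t ∈ H represents α, then (α, α) = α(t) and invariance gives 2 = α(h_α) = (t, [e, f]) =
α(t)(e, f). So the coefficient (α, α)/2 is the inverse of (e, f), which makes the operator act by
±1. -/
lemma dualForm_mul_form_eq_two (α : H.root) {e f : 𝔤} (he : e ∈ rootSpace H α.1)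
    (hef : ⁅e, f⁆ = (coroot α.1 : H)) :
    B.dualForm H ((rootSystem H).root α) ((rootSystem H).root α) * B.form e f = 2 := by
  set φ := (B.form.restrict H.toSubmodule).toDual (B.restrict_nondegenerate H)
  set t : H := φ.symm ((rootSystem H).root α)
  have h1 : ∀ h : H, B.form (t : 𝔤) h = α.1 h := fun h => by
    have := LinearMap.congr_fun (φ.apply_symm_apply ((rootSystem H).root α)) h
    exact this
  have h2 : B.dualForm H ((rootSystem H).root α) ((rootSystem H).root α) = α.1 t := h1 t
  have h3 := h1 (coroot α.1)
  rw [root_apply_coroot (H.isNonZero_coe_root α), B.form_comm, ← hef, B.form_lie, ← lie_skew,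
    lie_of_mem_rootSpace he t, map_neg, neg_neg, map_smul, smul_eq_mul, B.form_comm] at h3
  rw [h2, h3]

end InvForm

variable {b : (rootSystem H).Base} {e f : H.root → 𝔤}

open scoped Classical in
/-- The endomorphism of `𝔤` given by the standard solution of the modified classical Yang–Baxter
equation, the sum being over the positive roots in `R`. -/
def standardOperator (B : InvForm 𝔤) (b : (rootSystem H).Base) (e f : H.root → 𝔤)
    (R : Set H.root) : 𝔤 →ₗ[ℂ] 𝔤 :=
  ∑ α : H.root with b.IsPos α ∧ α ∈ R,
    (B.dualForm H ((rootSystem H).root α) ((rootSystem H).root α) / 2) •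
      ((B.form (e α)).smulRight (f α) - (B.form (f α)).smulRight (e α))

lemma rG_sub_rD (B : InvForm 𝔤) (D : Set H.root) :
    rG B b e f - rD B b e f D = standardR B b e f (diagRoots D)ᶜ := by
  rw [rG, rD, standardR, standardR, standardR]
  simp only [Finset.sum_filter, ← Finset.sum_sub_distrib]
  refine Finset.sum_congr rfl fun α _ => ?_
  by_cases h1 : b.IsPos α <;> by_cases h2 : α ∈ diagRoots D <;> simp [h1, h2]

/-- Under the identification of 𝔤 ⊗ 𝔤 with End 𝔤 by the form, the bivector is ∑ E_a ⊗ S E^a; a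
decomposable term x ∧ y acts by x ∧ ad y - y ∧ ad x. -/
lemma schouten_standardR (B : InvForm 𝔤) (R : Set H.root) :
    schouten (standardR B b e f R) = B.twistD (standardOperator B b e f R) := by
  refine LinearMap.ext fun ω => ?_
  rw [InvForm.twistD_apply, standardR, map_sum, LinearMap.sum_apply]
  simp only [standardOperator, LinearMap.sum_apply, map_sum, Finset.mul_sum]
  rw [Finset.sum_comm]
  refine Finset.sum_congr rfl fun α _ => ?_
  rw [map_smul, LinearMap.smul_apply, schouten_ι_mul_ι]
  simp only [LinearMap.smul_apply, LinearMap.sub_apply, LinearMap.smulRight_apply, map_smul,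
    map_sub, mul_smul_comm, mul_sub, ← Finset.smul_sum, Finset.sum_sub_distrib]
  congr 1
  have key : ∀ x y : 𝔤, ∑ a, B.form x (B.dual a) •
      (ExteriorAlgebra.ι ℂ (Module.finBasis ℂ 𝔤 a) * adExt 𝔤 y ω) =
        ExteriorAlgebra.ι ℂ x * adExt 𝔤 y ω := fun x y => by
    simp_rw [B.form_comm x]
    exact B.sum_form_smul (LinearMap.mulRight ℂ (adExt 𝔤 y ω) ∘ₗ ExteriorAlgebra.ι ℂ) x
  rw [key, key]

lemma add_ne_zero_of_isPos {α β : H.root} (hα : b.IsPos α) (hβ : b.IsPos β) :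
    (α.1 : H → ℂ) + β.1 ≠ 0 := by
  intro h
  obtain ⟨γ, hγ, hγpos⟩ := exists_neg_root b α
  have : γ = β := by
    refine Subtype.ext (DFunLike.coe_injective ?_)
    rw [hγ, eq_comm]
    exact eq_neg_of_add_eq_zero_right h
  exact hγpos.1 (this ▸ hβ) hα

omit [LieAlgebra.IsSemisimple ℂ 𝔤] in
lemma neg_add_ne_zero {α β : H.root} (hαβ : α ≠ β) : -(α.1 : H → ℂ) + β.1 ≠ 0 := fun h =>
  hαβ (Subtype.ext (DFunLike.coe_injective (neg_add_eq_zero.1 h)))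

variable (B : InvForm 𝔤) (hef : IsRootVectors b e f) (R : Set H.root)
include hef

lemma standardOperator_apply_cartan {x : 𝔤} (hx : x ∈ H) : standardOperator B b e f R x = 0 := by
  classical
  rw [standardOperator, LinearMap.sum_apply]
  refine Finset.sum_eq_zero fun α hα => ?_
  obtain ⟨he, hf, -⟩ := hef α (Finset.mem_filter.1 hα).2.1
  have h0 : (α.1 : H → ℂ) ≠ 0 := H.isNonZero_coe_root α
  replace hx : x ∈ rootSpace H (0 : H → ℂ) := by rwa [rootSpace_zero_eq]
  simp [B.form_eq_zero_of_mem_rootSpace he hx (by simp [h0]),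
    B.form_eq_zero_of_mem_rootSpace hf hx (by simp [h0])]

-- Only the summand of β survives, since 𝔤_β is orthogonal to every root space except 𝔤_{-β}; its
-- value is normalised by `dualForm_mul_form_eq_two`.
open scoped Classical in
lemma standardOperator_apply_of_isPos {β : H.root} (hβ : b.IsPos β) {x : 𝔤}
    (hx : x ∈ rootSpace H β.1) :
    standardOperator B b e f R x = (if β ∈ R then -1 else 0 : ℂ) • x := by
  have hne : ∀ α : H.root, b.IsPos α ∧ α ∈ R → α ≠ β →
      ((B.dualForm H ((rootSystem H).root α) ((rootSystem H).root α) / 2) •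
        ((B.form (e α)).smulRight (f α) - (B.form (f α)).smulRight (e α)) : 𝔤 →ₗ[ℂ] 𝔤) x = 0 := by
    intro α hα hαβ
    obtain ⟨he, hf, -⟩ := hef α hα.1
    simp [B.form_eq_zero_of_mem_rootSpace he hx (add_ne_zero_of_isPos hα.1 hβ),
      B.form_eq_zero_of_mem_rootSpace hf hx (neg_add_ne_zero hαβ)]
  rw [standardOperator, LinearMap.sum_apply]
  split_ifs with hR
  · rw [Finset.sum_eq_single β (fun α hα => hne α (Finset.mem_filter.1 hα).2)
      fun h => absurd (by simp [hβ, hR]) h]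
    obtain ⟨he, hf, h⟩ := hef β hβ
    have h2 := B.dualForm_mul_form_eq_two β he h
    have he0 : e β ≠ 0 := fun h0 => by simp [h0] at h2
    obtain ⟨c, rfl⟩ := exists_smul_eq_of_mem_rootSpace (H.isNonZero_coe_root β) he he0 hx
    simp only [map_smul, LinearMap.smul_apply, LinearMap.sub_apply, LinearMap.smulRight_apply,
      B.form_eq_zero_of_mem_rootSpace he he (add_ne_zero_of_isPos hβ hβ), B.form_comm (f β),
      zero_smul, zero_sub, smul_neg, smul_smul]
    rw [← neg_smul]
    congr 1
    linear_combination (-c / 2) * h2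
  · rw [zero_smul]
    refine Finset.sum_eq_zero fun α hα => ?_
    have hα := (Finset.mem_filter.1 hα).2
    exact hne α hα fun h => hR (h ▸ hα.2)

open scoped Classical in
lemma standardOperator_apply_of_isPos_neg {β : H.root} (hβ : b.IsPos β) {x : 𝔤}
    (hx : x ∈ rootSpace H (-β.1 : H → ℂ)) :
    standardOperator B b e f R x = (if β ∈ R then 1 else 0 : ℂ) • x := by
  have hne : ∀ α : H.root, b.IsPos α ∧ α ∈ R → α ≠ β →
      ((B.dualForm H ((rootSystem H).root α) ((rootSystem H).root α) / 2) •
        ((B.form (e α)).smulRight (f α) - (B.form (f α)).smulRight (e α)) : 𝔤 →ₗ[ℂ] 𝔤) x = 0 := by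
    intro α hα hαβ
    obtain ⟨he, hf, -⟩ := hef α hα.1
    simp [B.form_eq_zero_of_mem_rootSpace he hx
        (by rw [add_comm]; exact neg_add_ne_zero hαβ.symm),
      B.form_eq_zero_of_mem_rootSpace hf hx
        (by rw [← neg_add]; exact neg_ne_zero.2 (add_ne_zero_of_isPos hα.1 hβ))]
  rw [standardOperator, LinearMap.sum_apply]
  split_ifs with hR
  · rw [Finset.sum_eq_single β (fun α hα => hne α (Finset.mem_filter.1 hα).2)
      fun h => absurd (by simp [hβ, hR]) h]
    obtain ⟨he, hf, h⟩ := hef β hβ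
    have h2 := B.dualForm_mul_form_eq_two β he h
    have hf0 : f β ≠ 0 := fun h0 => by simp [h0] at h2
    obtain ⟨γ, hγ, -⟩ := exists_neg_root b β
    obtain ⟨c, rfl⟩ := exists_smul_eq_of_mem_rootSpace (H.isNonZero_coe_root γ)
      (show f β ∈ rootSpace H γ.1 by rwa [hγ]) hf0 (show x ∈ rootSpace H γ.1 by rwa [hγ])
    simp only [map_smul, LinearMap.smul_apply, LinearMap.sub_apply, LinearMap.smulRight_apply,
      B.form_eq_zero_of_mem_rootSpace hf hf
        (by rw [← neg_add]; exact neg_ne_zero.2 (add_ne_zero_of_isPos hβ hβ)),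
      zero_smul, sub_zero, smul_smul]
    congr 1
    linear_combination (c / 2) * h2
  · rw [zero_smul]
    refine Finset.sum_eq_zero fun α hα => ?_
    have hα := (Finset.mem_filter.1 hα).2
    exact hne α hα fun h => hR (h ▸ hα.2)

/-- The operator of `r_𝔤 - r_D` acts on the eigenspaces of the grading element by the opposite of
the sign of the eigenvalue. -/
lemma isSignOperator_standardOperator {D : Set H.root} (hD : D ⊆ b.support) {z : H}
    (h0 : ∀ α ∈ b.support, α ∈ D → α.1 z = 0) (h1 : ∀ α ∈ b.support, α ∉ D → α.1 z = 1) :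
    IsSignOperator (z : 𝔤) (standardOperator B b e f (diagRoots D)ᶜ) := by
  classical
  set S := standardOperator B b e f (diagRoots D)ᶜ
  have key : ∀ α : H.root, ∃ k : ℤ, α.1 z = k ∧
      ∀ x ∈ rootSpace H α.1, S x = -((k.sign : ℤ) : ℂ) • x := by
    have pos : ∀ α : H.root, b.IsPos α → ∃ n : ℕ, α.1 z = n ∧ (α ∈ diagRoots D ↔ n = 0) := by
      intro α hα
      obtain ⟨n, hn⟩ := (exists_nat_of_isPos h0 h1 hα).1
      refine ⟨n, hn, ?_⟩
      rw [mem_diagRoots_iff_of_isPos hD h0 h1 hα, hn, Nat.cast_eq_zero]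
    intro α
    by_cases hα : b.IsPos α
    · obtain ⟨n, hn, hn'⟩ := pos α hα
      refine ⟨n, by rw [hn, Int.cast_natCast], fun x hx => ?_⟩
      rw [standardOperator_apply_of_isPos B hef _ hα hx]
      rcases Nat.eq_zero_or_pos n with rfl | hpos
      · simp [hn']
      · simp [hn', hpos.ne', Int.sign_eq_one_of_pos (show (0 : ℤ) < n by exact_mod_cast hpos)]
    · obtain ⟨β, hβ, hβpos⟩ := exists_neg_root b α
      have hβpos := hβpos.2 hα
      obtain ⟨n, hn, hn'⟩ := pos β hβpos
      rw [hβ, Pi.neg_apply] at hn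
      refine ⟨-n, by rw [Int.cast_neg, Int.cast_natCast, ← hn, neg_neg], fun x hx => ?_⟩
      rw [standardOperator_apply_of_isPos_neg B hef _ hβpos (by rwa [hβ, neg_neg])]
      rcases Nat.eq_zero_or_pos n with rfl | hpos
      · simp [hn']
      · simp [hn', hpos.ne', Int.sign_eq_one_of_pos (show (0 : ℤ) < n by exact_mod_cast hpos)]
  refine ⟨eq_top_iff.2 fun x _ => ?_, fun k x hx => ?_⟩
  · induction x using rootSpace_induction (H := H) with
    | add x y hx hy => exact add_mem (hx trivial) (hy trivial)
    | cartan x hx => exact Submodule.subset_span ⟨0, by simpa using lie_cartan z.2 hx⟩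
    | root α x hx =>
      obtain ⟨k, hk, -⟩ := key α
      exact Submodule.subset_span ⟨k, by rw [lie_of_mem_rootSpace hx z, hk]⟩
  · have hA : LieAlgebra.ad ℂ 𝔤 z x = (k : ℂ) • x := hx
    -- The floor of the real part only serves to extend the sign from integers to a function of
    -- complex eigenvalues.
    have := apply_eq_smul_of_span_eigenvectors (A := LieAlgebra.ad ℂ 𝔤 z) (B := S)
      (s := fun μ => -((⌊μ.re⌋.sign : ℤ) : ℂ)) ?_ hA
    · simpa using this
    · refine eq_top_iff.2 fun x _ => ?_
      induction x using rootSpace_induction (H := H) with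
      | add x y hx hy => exact add_mem (hx trivial) (hy trivial)
      | cartan x hx =>
        refine Submodule.subset_span ⟨0, by simpa using lie_cartan z.2 hx, ?_⟩
        simpa using standardOperator_apply_cartan B hef _ hx
      | root α x hx =>
        obtain ⟨k, hk, hS⟩ := key α
        refine Submodule.subset_span ⟨k, ?_, ?_⟩
        · rw [LieAlgebra.ad_apply, lie_of_mem_rootSpace hx z, hk]
        · simpa using hS x hx

end SignOperator

/-! ### The Levi subalgebra as 𝔤_D plus its centre -/

section Levi

open LieAlgebra LieAlgebra.IsKilling LieModule

open scoped ComplexOrder in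
/-- The normal equations of a complex matrix are solvable. -/
lemma exists_conjTranspose_mul_self_mulVec {m n : Type*} [Fintype m] [Fintype n]
    (A : Matrix m n ℂ) (u : m → ℂ) :
    ∃ c : n → ℂ, A.conjTranspose.mulVec (A.mulVec c) = A.conjTranspose.mulVec u := by
  have h : LinearMap.range (A.conjTranspose * A).mulVecLin =
      LinearMap.range A.conjTranspose.mulVecLin := by
    refine Submodule.eq_of_le_of_finrank_eq ?_ ?_
    · rw [Matrix.mulVecLin_mul]
      exact LinearMap.range_comp_le_range _ _
    · exact (Matrix.rank_conjTranspose_mul_self A).trans (Matrix.rank_conjTranspose A).symm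
  obtain ⟨c, hc⟩ := h.ge (LinearMap.mem_range_self _ u)
  exact ⟨c, by simpa [Matrix.mulVec_mulVec] using hc⟩

variable {𝔤 : Type u} [LieRing 𝔤] [LieAlgebra ℂ 𝔤] [FiniteDimensional ℂ 𝔤]
  {H : LieSubalgebra ℂ 𝔤} [H.IsCartanSubalgebra] {D : Set H.root}

lemma lie_mem_diagSubalgebra_of_mem_cartan {h x : 𝔤} (hh : h ∈ H) (hx : x ∈ diagSubalgebra D) :
    ⁅h, x⁆ ∈ diagSubalgebra D := by
  induction hx using LieSubalgebra.lieSpan_induction with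
  | mem x hx =>
    refine LieSubalgebra.subset_lieSpan ?_
    obtain ⟨α, hα, hx | hx⟩ := hx
    · exact ⟨α, hα, Or.inl (LieSubmodule.lie_mem _ (x := (⟨h, hh⟩ : H)) hx)⟩
    · exact ⟨α, hα, Or.inr (LieSubmodule.lie_mem _ (x := (⟨h, hh⟩ : H)) hx)⟩
  | zero => simp
  | add x y _ _ h1 h2 => rw [lie_add]; exact add_mem h1 h2
  | smul c x _ h1 => rw [lie_smul]; exact (diagSubalgebra D).smul_mem c h1
  | lie x y hx hy h1 h2 =>
    rw [leibniz_lie]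
    exact add_mem ((diagSubalgebra D).lie_mem h1 hy) ((diagSubalgebra D).lie_mem hx h2)

lemma mem_levi {x : 𝔤} : x ∈ levi D ↔ ∃ y ∈ diagSubalgebra D, ∃ h ∈ H, y + h = x := by
  rw [← LieSubalgebra.mem_toSubmodule, toSubmodule_levi, Submodule.mem_sup]
  rfl

lemma diagSubalgebra_le_levi (D : Set H.root) : diagSubalgebra D ≤ levi D := le_sup_left

variable [LieAlgebra.IsSemisimple ℂ 𝔤]

/-- H is abelian and normalises 𝔤_D. This inclusion is what makes d² vanish already on the
invariants of 𝔤_D. -/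
lemma lie_mem_diagSubalgebra {x y : 𝔤} (hx : x ∈ levi D) (hy : y ∈ levi D) :
    ⁅x, y⁆ ∈ diagSubalgebra D := by
  obtain ⟨x₁, hx₁, x₂, hx₂, rfl⟩ := mem_levi.1 hx
  obtain ⟨y₁, hy₁, y₂, hy₂, rfl⟩ := mem_levi.1 hy
  rw [add_lie, lie_add, lie_add, lie_cartan hx₂ hy₂, add_zero, ← lie_skew x₁ y₂]
  exact add_mem (add_mem ((diagSubalgebra D).lie_mem hx₁ hy₁)
    (neg_mem (lie_mem_diagSubalgebra_of_mem_cartan hy₂ hx₁)))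
    (lie_mem_diagSubalgebra_of_mem_cartan hx₂ hy₁)

lemma coroot_mem_diagSubalgebra {α : H.root} (hα : α ∈ D) :
    ((coroot α.1 : H) : 𝔤) ∈ diagSubalgebra D := by
  obtain ⟨h, e, f, isSl2, he, hf⟩ :=
    exists_isSl2Triple_of_weight_isNonZero (H.isNonZero_coe_root α)
  rw [← isSl2.h_eq_coroot (H.isNonZero_coe_root α) he hf, ← isSl2.lie_e_f]
  exact (diagSubalgebra D).lie_mem (rootSpace_le_diagSubalgebra hα he)
    (rootSpace_neg_le_diagSubalgebra hα hf)

/-- The sum is the Killing form of the coroot and h, and the coroot represents a nonzero multiple of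
α. -/
lemma apply_eq_zero_of_sum_coroot {α : Weight ℂ H 𝔤} (hα : α.IsNonZero) {h : H}
    (hh : ∑ γ : H.root, γ.1 (coroot α) * γ.1 h = 0) : α h = 0 := by
  have h1 := traceForm_coroot α h
  have h2 := LinearMap.congr_fun₂ (restrict_killingForm_eq_sum (K := ℂ) (L := 𝔤) (H := H))
    (coroot α) h
  have h3 : ((killingForm ℂ 𝔤).restrict H.toSubmodule) (coroot α) h = 0 := by
    refine h2.trans ?_
    rw [← hh, ← Finset.sum_coe_sort]
    simp only [LinearMap.sum_apply]
    rfl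
  have h4 : traceForm ℂ H 𝔤 (coroot α) h = 0 := h3
  rw [h4] at h1
  have h5 := root_apply_cartanEquivDual_symm_ne_zero hα
  simpa [h5] using h1.symm

/-- The Cartan subalgebra is the sum of the coroots of `D` and of the common kernel of `D`. -/
lemma exists_mem_diagSubalgebra_of_mem_cartan (D : Set H.root) (h : H) :
    ∃ y : H, (y : 𝔤) ∈ diagSubalgebra D ∧ ∀ α ∈ D, α.1 (h - y) = 0 := by
  classical
  -- The product of the transpose of A with A is the Killing Gram matrix of the coroots of D. Since
  -- A has integer entries, its transpose is its conjugate transpose, so the equations for an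
  -- orthogonal projection of h to the span of these coroots are normal equations and have a
  -- solution.
  let A : Matrix H.root D ℂ := fun γ α => γ.1 (coroot α.1.1)
  have hA : A.conjTranspose = A.transpose := by
    ext α γ
    change star (γ.1 (coroot α.1.1)) = γ.1 (coroot α.1.1)
    rw [apply_coroot_eq_cast']
    simp
  obtain ⟨c, hc⟩ := exists_conjTranspose_mul_self_mulVec A fun γ => γ.1 h
  rw [hA] at hc
  refine ⟨∑ α : D, c α • coroot α.1.1, ?_, fun α hα => ?_⟩
  · push_cast
    exact sum_mem fun α _ => (diagSubalgebra D).smul_mem _ (coroot_mem_diagSubalgebra α.2)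
  · refine apply_eq_zero_of_sum_coroot (H.isNonZero_coe_root α) ?_
    have h1 : ∑ γ : H.root, γ.1 (coroot α.1) * γ.1 (∑ β : D, c β • coroot β.1.1) =
        ∑ γ : H.root, γ.1 (coroot α.1) * γ.1 h := by
      refine Eq.trans ?_ (congrFun hc ⟨α, hα⟩)
      simp only [Matrix.mulVec, dotProduct, A]
      refine Finset.sum_congr rfl fun γ _ => ?_
      congr 1
      rw [← Weight.toLinear_apply, map_sum]
      refine Finset.sum_congr rfl fun β _ => ?_
      rw [map_smul, smul_eq_mul, mul_comm, Weight.toLinear_apply]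
    have h2 : ∀ (γ : H.root) (x y : H), γ.1 (x - y) = γ.1 x - γ.1 y := fun γ x y =>
      map_sub (Weight.toLinear ℂ H 𝔤 γ.1) x y
    simp only [h2, mul_sub, Finset.sum_sub_distrib, h1, sub_self]

/-- `𝔩_D` is the sum of `𝔤_D` and its centre. -/
lemma exists_add_eq_of_mem_levi {x : 𝔤} (hx : x ∈ levi D) :
    ∃ y ∈ diagSubalgebra D, ∃ c : 𝔤, (∀ w ∈ levi D, ⁅c, w⁆ = 0) ∧ y + c = x := by
  obtain ⟨y, hy, h, hh, rfl⟩ := mem_levi.1 hx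
  obtain ⟨y', hy', h0⟩ := exists_mem_diagSubalgebra_of_mem_cartan D ⟨h, hh⟩
  exact ⟨y + y', add_mem hy hy', (⟨h, hh⟩ - y' : H),
    fun w hw => lie_eq_zero_of_mem_levi (SetLike.coe_mem _) h0 hw, by push_cast; abel⟩

namespace IsSignOperator

variable {b : (rootSystem H).Base} {z : H} {S : 𝔤 →ₗ[ℂ] 𝔤} (h : IsSignOperator (z : 𝔤) S)
  (hD : D ⊆ b.support)
  (h0 : ∀ α ∈ b.support, α ∈ D → α.1 z = 0) (h1 : ∀ α ∈ b.support, α ∉ D → α.1 z = 1)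
include h hD h0 h1

omit h1 in
lemma proj_of_mem_levi {x : 𝔤} (hx : x ∈ levi D) :
    (LinearMap.id - S ∘ₗ S : 𝔤 →ₗ[ℂ] 𝔤) x = x :=
  h.proj_of_lie_eq_zero (lie_eq_zero_of_mem_levi z.2 (fun α hα => h0 α (hD hα) hα) hx)

/-- The image of the exterior algebra of `𝔩_D` consists of the elements fixed by the projection. -/
lemma mem_map_exteriorPower_levi_iff {n : ℕ} {ω : ExteriorAlgebra ℂ 𝔤} :
    ω ∈ (⋀[ℂ]^n (levi D)).map (ExteriorAlgebra.map (levi D).toSubmodule.subtype).toLinearMap ↔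
      ω ∈ ⋀[ℂ]^n 𝔤 ∧ ExteriorAlgebra.map (LinearMap.id - S ∘ₗ S) ω = ω := by
  constructor
  · rintro ⟨η, hη, rfl⟩
    refine ⟨map_mem_exteriorPower (𝔤 := levi D) (levi D).toSubmodule.subtype hη, ?_⟩
    have h2 : (LinearMap.id - S ∘ₗ S : 𝔤 →ₗ[ℂ] 𝔤) ∘ₗ (levi D).toSubmodule.subtype =
        (levi D).toSubmodule.subtype :=
      LinearMap.ext fun x => h.proj_of_mem_levi hD h0 x.2
    have h3 := AlgHom.congr_fun (ExteriorAlgebra.map_comp_map (levi D).toSubmodule.subtype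
      (LinearMap.id - S ∘ₗ S : 𝔤 →ₗ[ℂ] 𝔤)) η
    rw [h2] at h3
    exact h3
  · rintro ⟨hω, hP⟩
    let π : 𝔤 →ₗ[ℂ] levi D := LinearMap.codRestrict (levi D).toSubmodule
      (LinearMap.id - S ∘ₗ S : 𝔤 →ₗ[ℂ] 𝔤) (h.proj_mem_levi h0 h1)
    refine ⟨ExteriorAlgebra.map π ω, map_mem_exteriorPower π hω, ?_⟩
    have h3 := AlgHom.congr_fun (ExteriorAlgebra.map_comp_map π (levi D).toSubmodule.subtype) ω
    exact h3.trans hP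

omit hD in
/-- Invariants of `𝔤_D` in the exterior algebra of `𝔩_D` are invariants of `𝔩_D`. -/
lemma mem_invariants_levi {ω : ExteriorAlgebra ℂ 𝔤} (hω : ω ∈ invariants (diagSubalgebra D))
    (hP : ExteriorAlgebra.map (LinearMap.id - S ∘ₗ S) ω = ω) : ω ∈ invariants (levi D) := by
  rw [mem_invariants] at hω ⊢
  intro x hx
  obtain ⟨y, hy, c, hc, rfl⟩ := exists_add_eq_of_mem_levi hx
  -- The central element c kills the image of the projection, so its adjoint action corresponds
  -- there to the zero derivation.
  rw [map_add, derivExt_add, hω y hy, zero_add, ← hP,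
    derivExt_map _ _ 0 (LinearMap.ext fun w => ?_), derivExt_zero, map_zero]
  simpa using hc _ (h.proj_mem_levi h0 h1 w)

end IsSignOperator

omit [LieAlgebra.IsSemisimple ℂ 𝔤] in
lemma invPart_levi_le (D : Set H.root) (n : ℕ) : invPart (levi D) n ≤ invPart (diagSubalgebra D) n :=
  fun _ hω => ⟨hω.1, mem_invariants.2 fun x hx =>
    mem_invariants.1 hω.2 x (diagSubalgebra_le_levi D hx)⟩

namespace IsSignOperator

variable {b : (rootSystem H).Base} {z : H} {S : 𝔤 →ₗ[ℂ] 𝔤} (h : IsSignOperator (z : 𝔤) S)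
  (hD : D ⊆ b.support)
  (h0 : ∀ α ∈ b.support, α ∈ D → α.1 z = 0) (h1 : ∀ α ∈ b.support, α ∉ D → α.1 z = 1)
include h hD h0 h1

lemma mem_selfInvPart_iff_levi (n : ℕ) (ω : ExteriorAlgebra ℂ 𝔤) :
    ω ∈ selfInvPart (levi D) n ↔
      ω ∈ invPart (levi D) n ∧ ExteriorAlgebra.map (LinearMap.id - S ∘ₗ S) ω = ω := by
  rw [selfInvPart, Submodule.mem_inf, h.mem_map_exteriorPower_levi_iff hD h0 h1, invPart,
    Submodule.mem_inf]
  tauto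

/-- This exhibits the small complex as the fixed part of the larger complex too, so the homotopy
argument applies to it directly. -/
lemma mem_selfInvPart_iff_diagSubalgebra (n : ℕ) (ω : ExteriorAlgebra ℂ 𝔤) :
    ω ∈ selfInvPart (levi D) n ↔
      ω ∈ invPart (diagSubalgebra D) n ∧ ExteriorAlgebra.map (LinearMap.id - S ∘ₗ S) ω = ω := by
  rw [h.mem_selfInvPart_iff_levi hD h0 h1]
  exact ⟨fun hω => ⟨invPart_levi_le D n hω.1, hω.2⟩, fun hω =>
    ⟨⟨hω.1.1, h.mem_invariants_levi h0 h1 hω.1.2 hω.2⟩, hω.2⟩⟩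

end IsSignOperator

end Levi

/-! ### Composition of inclusions -/

section Complexes

variable {E : Type u} [AddCommGroup E] [Module ℂ E] {V W U : ℕ → Submodule ℂ E}
  {d d' d'' : E →ₗ[ℂ] E}

lemma subComplexIncl_comp (hV : IsCochainDatum V d) (hW : IsCochainDatum W d')
    (hU : IsCochainDatum U d'') (h₁ : ∀ n, V n ≤ W n) (h₂ : ∀ n, W n ≤ U n)
    (e₁ : ∀ n, ∀ x ∈ V n, d x = d' x) (e₂ : ∀ n, ∀ x ∈ W n, d' x = d'' x)
    (e₃ : ∀ n, ∀ x ∈ V n, d x = d'' x) :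
    subComplexIncl hV hW h₁ e₁ ≫ subComplexIncl hW hU h₂ e₂ =
      subComplexIncl hV hU (fun n => (h₁ n).trans (h₂ n)) e₃ := by
  ext n x
  rfl

end Complexes

end RelTwist

end

open RelTwist

theorem mainTheorem3 {𝔤 : Type*} [LieRing 𝔤] [LieAlgebra ℂ 𝔤] [FiniteDimensional ℂ 𝔤]
    [LieAlgebra.IsSemisimple ℂ 𝔤] (H : LieSubalgebra ℂ 𝔤) [H.IsCartanSubalgebra]
    (b : (LieAlgebra.IsKilling.rootSystem H).Base) (D : Set H.root) (hD : D ⊆ b.support)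
    (B : InvForm 𝔤) (e f : H.root → 𝔤) (hef : IsRootVectors b e f) :
    ∃ (h₀ : IsCochainDatum (selfInvPart (levi D)) 0)
      (h₁ : IsCochainDatum (invPart (levi D))
        (schouten (rG B b e f - rD B b e f D)))
      (h₂ : IsCochainDatum (invPart (diagSubalgebra D))
        (schouten (rG B b e f - rD B b e f D)))
      (le₀₁ : ∀ n, selfInvPart (levi D) n ≤ invPart (levi D) n)
      (d₀₁ : ∀ n, ∀ ω ∈ selfInvPart (levi D) n,
        (0 : ExteriorAlgebra ℂ 𝔤 →ₗ[ℂ] ExteriorAlgebra ℂ 𝔤) ω =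
          schouten (rG B b e f - rD B b e f D) ω)
      (le₁₂ : ∀ n, invPart (levi D) n ≤
        invPart (diagSubalgebra D) n),
      QuasiIso (subComplexIncl h₀ h₁ le₀₁ d₀₁) ∧
        QuasiIso (subComplexIncl h₁ h₂ le₁₂ (fun _ _ _ => rfl)) := by
  obtain ⟨z, hz0, hz1⟩ := exists_grading_element b D
  have hS := isSignOperator_standardOperator B hef hD hz0 hz1
  have hr : schouten (rG B b e f - rD B b e f D) =
      B.twistD (standardOperator B b e f (diagRoots D)ᶜ) := by
    rw [rG_sub_rD, schouten_standardR]
  rw [hr]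
  set S := standardOperator B b e f (diagRoots D)ᶜ
  have levi_of_lie : ∀ x : 𝔤, ⁅(z : 𝔤), x⁆ = 0 → x ∈ levi D := fun x hx => by
    rw [← hS.proj_of_lie_eq_zero hx]
    exact hS.proj_mem_levi hz0 hz1 x
  -- The centraliser of z is 𝔩_D, and its brackets lie in 𝔤_D; this is the condition for d² = 0.
  have hs : ∀ x y : 𝔤, ⁅(z : 𝔤), x⁆ = 0 → ⁅(z : 𝔤), y⁆ = 0 → ⁅x, y⁆ ∈ diagSubalgebra D :=
    fun x y hx hy => lie_mem_diagSubalgebra (levi_of_lie x hx) (levi_of_lie y hy)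
  have hs' : ∀ x y : 𝔤, ⁅(z : 𝔤), x⁆ = 0 → ⁅(z : 𝔤), y⁆ = 0 → ⁅x, y⁆ ∈ levi D :=
    fun x y hx hy => diagSubalgebra_le_levi D (hs x y hx hy)
  have hz' : ∀ x ∈ levi D, ⁅(z : 𝔤), x⁆ = 0 := fun x hx =>
    lie_eq_zero_of_mem_levi z.2 (fun α hα => hz0 α (hD hα) hα) hx
  have hz : ∀ x ∈ diagSubalgebra D, ⁅(z : 𝔤), x⁆ = 0 := fun x hx =>
    hz' x (diagSubalgebra_le_levi D hx)
  have hV' := hS.mem_selfInvPart_iff_levi hD hz0 hz1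
  have hV := hS.mem_selfInvPart_iff_diagSubalgebra hD hz0 hz1
  have h₀ : IsCochainDatum (selfInvPart (levi D)) 0 :=
    ⟨fun _ _ _ => zero_mem _, fun _ _ _ => rfl⟩
  have h₁ := hS.isCochainDatum B hz' hs'
  have h₂ := hS.isCochainDatum B hz hs
  have le₀₁ : ∀ n, selfInvPart (levi D) n ≤ invPart (levi D) n := fun n ω hω =>
    ((hV' n ω).1 hω).1
  have d₀₁ : ∀ n, ∀ ω ∈ selfInvPart (levi D) n,
      (0 : ExteriorAlgebra ℂ 𝔤 →ₗ[ℂ] ExteriorAlgebra ℂ 𝔤) ω = B.twistD S ω := fun n ω hω =>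
    (hS.twistD_eq_zero_of_map_proj B ((hV' n ω).1 hω).2).symm
  have le₁₂ := invPart_levi_le D
  have q₁ := hS.quasiIso_subComplexIncl B hz' hs' hV' h₀ h₁ le₀₁ d₀₁
  have q₂ := hS.quasiIso_subComplexIncl B hz hs hV h₀ h₂ (fun n => (le₀₁ n).trans (le₁₂ n)) d₀₁
  refine ⟨h₀, h₁, h₂, le₀₁, d₀₁, le₁₂, q₁, ?_⟩
  -- The second inclusion is not treated directly: its composite with the first is a
  -- quasi-isomorphism, and so is the first.
  rw [← subComplexIncl_comp h₀ h₁ h₂ le₀₁ le₁₂ d₀₁ (fun _ _ _ => rfl) d₀₁] at q₂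
  exact quasiIso_of_comp_left (subComplexIncl h₀ h₁ le₀₁ d₀₁) _
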